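/- **Model.** Let $\mathcal S,\mathcal A$ be finite non-empty sets of sizes $S,A$, let $H,K,m\ge 1$, let $p_h(\cdot\mid s,a)$ ($h\in[H]$) be a known transition function on $\mathcal S$, let $s_{\rm init}\in\mathcal S$, and let $c^1,\dots,c^K\in[0,1]^{HSA}$ be cost functions fixed in advance. In each episode $m$ agents start in $s_{\rm init}$. Randomness is *non-fresh*: at the start of an episode a next state $\sigma_h(s,a)\sim p_h(\cdot\mid s,a)$ is drawn independently for every $(h,s,a)$, and every agent that takes action $a$ in state $s$ at step $h$ moves to $\sigma_h(s,a)$; actions are sampled by each agent independently from its policy. For a policy $\pi$ let $q^\pi_h(s,a)$ be the probability that a single agent playing $\pi$ visits $(s,a)$ at step $h$, $\Delta(\mathcal M)=\{q^\pi\}_\pi$ the set of occupancy measures, and $W^\pi_h(s,a)$ the probability that at least one of $m$ agents, all playing $\pi$ in the same episode, visits $(s,a)$ at step $h$. Let $V^{k,\pi}_1(s_{\rm init})$ be the expected total cost of $\pi$ in an episode under $c^k$. If agent $v$ plays $\pi^{k,v}$ in episode $k$, the regret is $$R_K=\max_{v\in[m]}\sum_{k=1}^K V_1^{k,\pi^{k,v}}(s_{\rm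 init})-\min_\pi\sum_{k=1}^K V_1^{k,\pi}(s_{\rm init}).$$ **Algorithm (coop-nf-O-REPS)** with parameters $\eta,\gamma>0$ and $\delta\in(0,1)$. Start with $q^1=\arg\min_{q\in\Delta(\mathcal M)}\sum_{h,s,a}q_h(s,a)\log q_h(s,a)$. In episode $k$ all agents play $\pi^k_h(a\mid s)=q^k_h(s,a)/\sum_{a'}q^k_h(s,a')$ (uniform where the denominator is $0$). For every $(s,a,h)$ let $\widetilde W^k_h(s,a)$ be the fraction of $N=\lceil 10\gamma^{-2}\log\frac{KHSAm}{\delta}\rceil$ independent simulated $m$-agent episodes under $\pi^k$ in which some agent visits $(s,a)$ at step $h$; put $$\hat c^k_h(s,a)=\frac{c^k_h(s,a)\,\mathbb 1\{\text{some agent visited }(s,a)\text{ at step }h\text{ of episode }k\}}{\widetilde W^k_h(s,a)+\gamma},\qquad q^{k+1}=\arg\min_{q\in\Delta(\mathcal M)}\ \eta\langle q,\hat c^k\rangle+\mathrm{KL}(q\,\|\,q^k),$$ where $\mathrm{KL}(q\|q')=\sum_{h,s,a}q_h(s,a)\log\frac{q_h(s,a)}{q'_h(s,a)}$. **Theorem.**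 (i) For every policy $\pi$ and all $(s,a,h)$, $\;q^\pi_h(s,a)\le\bigl(\frac1m+\pi_h(a\mid s)\bigr)W^\pi_h(s,a)$. (ii) There is an absolute constant $C>0$ such that for all $\mathcal S,\mathcal A,H,K,m,p,s_{\rm init},c^1,\dots,c^K$ and $\delta\in(0,1)$ as above, if $\eta=\gamma=\sqrt{\dfrac{\log(HSA/\delta)}{(1+A/m)\,SK}}$, then with probability at least $1-\delta$ the regret of coop-nf-O-REPS (hence the individual regret of each agent) satisfies $$R_K\le C\left(H\sqrt{SK\log\tfrac{HSA}{\delta}}+\sqrt{\tfrac{H^2SAK}{m}\log\tfrac{HSA}{\delta}}+\tfrac{HSA}{m}\log\tfrac{HSA}{\delta}+HS\log\tfrac{HSA}{\delta}\right).$$ -/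

import Mathlib

open scoped ENNReal

noncomputable section

namespace CoopMDP

universe u v

/-- The law of a family of independent draws, `f i ∼ p i`, over a finite index set. -/
def piPMF {ι : Type*} [Fintype ι] [DecidableEq ι] {α : ι → Type*} [∀ i, Fintype (α i)]
    (p : ∀ i, PMF (α i)) : PMF (∀ i, α i) :=
  PMF.ofFintype (fun f => ∏ i, p i (f i)) (by
    have h := Finset.prod_univ_sum (fun i => (Finset.univ : Finset (α i))) (fun i a => p i a)
    rw [Fintype.piFinset_univ] at h
    rw [← h]
    refine Finset.prod_eq_one fun i _ => ?_
    rw [← tsum_fintype (L := SummationFilter.unconditional _)]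
    exact (p i).tsum_coe)

/-- A finite-horizon episodic MDP without its costs: transition kernel and initial state.
The steps `1, …, H` are indexed by `Fin H`, i.e. `0, …, H - 1`. -/
structure EpisodicMDP (S : Type u) (A : Type v) (H : ℕ) where
  trans : Fin H → S → A → PMF S
  init : S

/-- Stochastic Markov policies; `π h s a` is `π_h(a ∣ s)`. -/
abbrev Policy (S : Type u) (A : Type v) (H : ℕ) := Fin H → S → PMF A

/-- Vectors indexed by `[H] × S × A`: cost functions, estimated costs, occupancy measures. -/
abbrev Tab (S : Type u) (A : Type v) (H : ℕ) := Fin H → S → A → ℝ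

section

variable {S : Type u} {A : Type v} {H : ℕ}
  [Fintype S] [DecidableEq S] [Fintype A] [DecidableEq A]

/-! ### Values, regret, occupancy measures -/

/-- The value function: `value M c π h s` is the expected cost of `π` from state `s` at step `h`
to the end of the episode, by the Bellman equations. -/
def value (M : EpisodicMDP S A H) (c : Tab S A H) (π : Policy S A H) (h : ℕ) (s : S) : ℝ :=
  if hh : h < H then
    ∑ a, (π ⟨h, hh⟩ s a).toReal *
      (c ⟨h, hh⟩ s a + ∑ s', (M.trans ⟨h, hh⟩ s a s').toReal * value M c π (h + 1) s')
  else 0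
termination_by H - h

/-- The (maximal individual) regret of a team of `m` agents that plays policy `pol k v` as agent
`v` in episode `k`, against the best fixed policy in hindsight. -/
def regret (M : EpisodicMDP S A H) (c : ℕ → Tab S A H) {K m : ℕ}
    (pol : Fin K → Fin m → Policy S A H) : ℝ :=
  (⨆ v : Fin m, ∑ k : Fin K, value M (c k) (pol k v) 0 M.init) -
    ⨅ π : Policy S A H, ∑ k : Fin K, value M (c k) π 0 M.init

/-- The law of the state at step `h` of a single agent that plays `π`. -/
def stateLaw (M : EpisodicMDP S A H) (π : Policy S A H) : ℕ → PMF S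
  | 0 => PMF.pure M.init
  | h + 1 =>
    if hh : h < H then
      (stateLaw M π h).bind fun s => (π ⟨h, hh⟩ s).bind fun a => M.trans ⟨h, hh⟩ s a
    else stateLaw M π h

/-- The occupancy measure `q^π_h(s,a) = q^π_h(s) π_h(a ∣ s)`. -/
def occupancy (M : EpisodicMDP S A H) (π : Policy S A H) : Tab S A H :=
  fun h s a => (stateLaw M π h s).toReal * (π h s a).toReal

/-- `Δ(M)`, the set of occupancy measures of all stochastic policies. -/
def occSet (M : EpisodicMDP S A H) : Set (Tab S A H) := Set.range (occupancy M)

/-- The policy `π_h(a ∣ s) = q_h(s,a) / ∑ a', q_h(s,a')`, uniform at the pairs `(h,s)` with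
`∑ a', q_h(s,a') = 0` (never reached under `q`). -/
def policyOf [Nonempty A] (q : Tab S A H) : Policy S A H := fun h s =>
  if hq : ∑' a, ENNReal.ofReal (q h s a) = 0 then PMF.uniformOfFintype A
  else PMF.normalize (fun a => ENNReal.ofReal (q h s a)) hq (by
    rw [tsum_fintype]
    exact ENNReal.sum_ne_top.2 fun a _ => ENNReal.ofReal_ne_top)

/-! ### Online mirror descent on occupancy measures -/

/-- `⟨q, c⟩`. -/
def dot (q c : Tab S A H) : ℝ := ∑ h, ∑ s, ∑ a, q h s a * c h s a

open scoped Classical in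
/-- The KL-divergence `∑ q log (q / q')` between occupancy measures (`0 log 0 = 0`, and `⊤` unless
`q` vanishes wherever `q'` does). -/
def kl (q q' : Tab S A H) : EReal :=
  if ∀ h s a, q' h s a = 0 → q h s a = 0 then
    ((∑ h, ∑ s, ∑ a, q h s a * Real.log (q h s a / q' h s a) : ℝ) : EReal)
  else ⊤

/-- The entropic regularizer `∑ q log q`. -/
def negEntropy (q : Tab S A H) : ℝ := ∑ h, ∑ s, ∑ a, q h s a * Real.log (q h s a)

/-- A minimizer of `f` over `D`. (It is only used for problems with exactly one minimizer.) -/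
def argminOn {β : Type*} [Preorder β] (f : Tab S A H → β) (D : Set (Tab S A H)) : Tab S A H :=
  Classical.epsilon fun q => q ∈ D ∧ IsMinOn f D q

/-- The starting point of mirror descent: the minimizer of the regularizer over `Δ(M)`. -/
def initOcc (M : EpisodicMDP S A H) : Tab S A H := argminOn negEntropy (occSet M)

/-- `argmin_{q' ∈ Δ(M)} η ⟨q', ĉ⟩ + KL(q' ‖ q)`. -/
def mirrorStep (M : EpisodicMDP S A H) (η : ℝ) (chat q : Tab S A H) : Tab S A H :=
  argminOn (fun q' => ((η * dot q' chat : ℝ) : EReal) + kl q' q) (occSet M)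

/-! ### Episodes with non-fresh randomness -/

/-- The randomness of one episode of `m` agents. First component: the realized transitions
`σ h s a`, one next state for every `(h,s,a)`, shared by all agents. Second component: `α v h s` is
the action that agent `v` picks if its state at step `h` is `s`. -/
abbrev Rollout (S : Type u) (A : Type v) (H m : ℕ) :=
  (Fin H → S → A → S) × (Fin m → Fin H → S → A)

/-- The law of an episode in which all `m` agents play `π`: `σ h s a ∼ p_h(· ∣ s,a)` and
`α v h s ∼ π_h(· ∣ s)`, all independent. (An agent is in one state at each step, so it reads each
entry of its table at most once: its actions are sampled from `π_h(· ∣ s_h)` with fresh private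
randomness.) -/
def rolloutLaw (M : EpisodicMDP S A H) (π : Policy S A H) (m : ℕ) : PMF (Rollout S A H m) :=
  (piPMF fun h => piPMF fun s => piPMF fun a => M.trans h s a).bind fun σ =>
    (piPMF fun _ : Fin m => piPMF fun h => piPMF fun s => π h s).map fun α => (σ, α)

/-- The state of agent `v` at step `h` of the episode: all start in the initial state, and an agent
that takes action `a` in state `s` at step `h` moves to `σ h s a`. -/
def agentState (M : EpisodicMDP S A H) {m : ℕ} (ω : Rollout S A H m) (v : Fin m) : ℕ → S
  | 0 => M.init
  | h + 1 =>
    if hh : h < H then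
      ω.1 ⟨h, hh⟩ (agentState M ω v h) (ω.2 v ⟨h, hh⟩ (agentState M ω v h))
    else agentState M ω v h

/-- Some agent is in state `s` and takes action `a` at step `h`. -/
def Visited (M : EpisodicMDP S A H) {m : ℕ} (ω : Rollout S A H m) (h : Fin H) (s : S) (a : A) :
    Prop :=
  ∃ v : Fin m, agentState M ω v h = s ∧ ω.2 v h (agentState M ω v h) = a

/-- `W_h(s,a)`: the probability that some agent visits `(s,a)` at step `h` when all `m` agents
play `π`. -/
def reachProb (M : EpisodicMDP S A H) (π : Policy S A H) (m : ℕ) : Tab S A H :=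
  fun h s a => ((rolloutLaw M π m).toOuterMeasure {ω | Visited M ω h s a}).toReal

/-! ### The algorithm coop-nf-O-REPS -/

/-- The randomness of one episode of the algorithm: the real episode and, for every `(h,s,a)`,
the `N` simulated episodes used to estimate `W_h(s,a)`. -/
abbrev Outcome (S : Type u) (A : Type v) (H m N : ℕ) :=
  Rollout S A H m × (Fin H × S × A × Fin N → Rollout S A H m)

/-- The real and the simulated episodes are independent, with all agents playing `π`. -/
def outcomeLaw (M : EpisodicMDP S A H) (π : Policy S A H) (m N : ℕ) : PMF (Outcome S A H m N) :=
  (rolloutLaw M π m).bind fun ω =>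
    (piPMF fun _ : Fin H × S × A × Fin N => rolloutLaw M π m).map fun sim => (ω, sim)

open scoped Classical in
/-- The Monte Carlo estimate of `W_h(s,a)`: the fraction of the `N` simulated episodes in which
some agent visits `(s,a)` at step `h`. -/
def reachEst (M : EpisodicMDP S A H) {m N : ℕ} (o : Outcome S A H m N) : Tab S A H :=
  fun h s a => (∑ n : Fin N, if Visited M (o.2 (h, s, a, n)) h s a then (1 : ℝ) else 0) / N

open scoped Classical in
/-- The cost estimator: `c_h(s,a) / (estimate of W_h(s,a) + γ)` if some agent visited `(s,a)` at
step `h` in the real episode, and `0` otherwise. -/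
def costEst (M : EpisodicMDP S A H) {m N : ℕ} (c : Tab S A H) (γ : ℝ) (o : Outcome S A H m N) :
    Tab S A H :=
  fun h s a => if Visited M o.1 h s a then c h s a / (reachEst M o h s a + γ) else 0

/-- The occupancy measure that the algorithm holds after the `k` episodes recorded in `ω`. -/
def iterate (M : EpisodicMDP S A H) {m N : ℕ} (c : ℕ → Tab S A H) (η γ : ℝ) :
    (k : ℕ) → (Fin k → Outcome S A H m N) → Tab S A H
  | 0, _ => initOcc M
  | k + 1, ω =>
    mirrorStep M η (costEst M (c k) γ (ω (Fin.last k))) (iterate M c η γ k (Fin.init ω))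

/-- The joint law of the first `k` episodes of the algorithm: given the past, all agents play (and
the simulation uses) the policy of the current occupancy measure. -/
def runLaw [Nonempty A] (M : EpisodicMDP S A H) (m N : ℕ) (c : ℕ → Tab S A H) (η γ : ℝ) :
    (k : ℕ) → PMF (Fin k → Outcome S A H m N)
  | 0 => PMF.pure Fin.elim0
  | k + 1 =>
    (runLaw M m N c η γ k).bind fun ω =>
      (outcomeLaw M (policyOf (iterate M c η γ k ω)) m N).map fun o => Fin.snoc ω o

/-- The policy that agent `v` plays in episode `k` of a run `ω` over `K` episodes: every agent
plays the policy of the current occupancy measure, which depends on the earlier episodes only. -/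
def agentPolicy [Nonempty A] (M : EpisodicMDP S A H) {m N K : ℕ} (c : ℕ → Tab S A H) (η γ : ℝ)
    (ω : Fin K → Outcome S A H m N) (k : Fin K) (_v : Fin m) : Policy S A H :=
  policyOf (iterate M c η γ k fun i => ω (Fin.castLE k.isLt.le i))

end

/-! ### Parameters (`S`, `A` are the numbers of states and actions) -/

/-- The common value of the learning rate `η` and the exploration parameter `γ`. -/
def rate (S A H K m : ℕ) (δ : ℝ) : ℝ :=
  √(Real.log ((H : ℝ) * S * A / δ) / ((1 + (A : ℝ) / m) * S * K))

/-- The number of simulated episodes, `10 γ⁻² log (K H S A m / δ)` rounded up. -/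
def numSamples (S A H K m : ℕ) (δ γ : ℝ) : ℕ :=
  ⌈10 / γ ^ 2 * Real.log ((K : ℝ) * H * S * A * m / δ)⌉₊

/-- The regret bound, without its absolute constant. -/
def regretBound (S A H K m : ℕ) (δ : ℝ) : ℝ :=
  H * √((S : ℝ) * K * Real.log ((H : ℝ) * S * A / δ))
    + √((H : ℝ) ^ 2 * S * A * K / m * Real.log ((H : ℝ) * S * A / δ))
    + (H : ℝ) * S * A / m * Real.log ((H : ℝ) * S * A / δ)
    + (H : ℝ) * S * Real.log ((H : ℝ) * S * A / δ)

end CoopMDP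

end

/-!
The first part holds conditionally on the realized transitions, which all agents share. Given them
the `m` agents are independent, and each visits `(s,a)` at step `h` with the same probability
`y = x π_h(a ∣ s)`, where `x` is the conditional probability of being in state `s`. Bernoulli's
inequality gives `1 - (1 - y) ^ m ≥ m y / (1 + m y)`, that is `y ≤ (1 / m + y) (1 - (1 - y) ^ m)`,
and averaging over the transitions turns `y` into the occupancy measure and `1 - (1 - y) ^ m` into
the reachability (`occupancy_le_mul_reachProb`).

For the regret, write `W` for the reachability, `q` for the played occupancy measure and `ĉ` for the
estimated cost. Values are linear in occupancy measures (`value_eq_dot`), so the regret against `u`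
splits into `∑ ⟨q, c - ĉ⟩ + ∑ ⟨q - u, ĉ⟩ + ∑ ⟨u, ĉ - c⟩`.

* The middle sum is the regret of mirror descent (`mirror_descent_regret`), at most
  `H log (S A) / η + η ∑ ⟨q, ĉ²⟩`. The set of occupancy measures is a compact convex polytope
  (`mem_occSet_iff`), on which an entropic objective has a minimizer; comparing the minimizer with
  the points of the segment towards `u` shows both that it has full support and that the
  generalized Pythagorean inequality holds (`eq_zero_of_isMinOn`, `relEnt_le_of_isMinOn`).
* If the simulation is accurate to within `γ / 2` (`prob_not_goodEst_le`, by Hoeffding's lemma), the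
  estimator `ĉ` divides by a weight between `W + γ / 2` and `W + 3 γ / 2`. This implicit
  exploration gives `∑ (ĉ - c) ≤ log (1 / δ') / γ` for each entry
  (`expect_exp_weightedEst_le_one`), which controls the third sum for all `u` at once.
* By the first part, `q / W` is at most `1 / m + π`, whose sum over all entries is
  `H S (1 + A / m)`. This bounds the bias of `⟨q, ĉ⟩` and the mean of `⟨q, ĉ²⟩`. As at most `m` pairs
  are visited at each step, `⟨q, ĉ⟩` never exceeds `H (1 + S)` (`dot_weightedEst_le`). Its mean is at
  most `H`, so its second moment is at most `H² (1 + S)`, which controls the lower tail of the first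
  sum (`expect_exp_sub_dot_weightedEst_le_one`). As `ĉ ≤ 1 / γ`, the same range controls the upper
  tail of `γ ∑ ⟨q, ĉ²⟩` (`expect_exp_dot_sq_le_one`).

The tail bounds are exponential moments of sums adapted to the run (`prob_le_pathSum_le`). All laws
live on finite types, so expectations are finite sums.
-/

open scoped ENNReal

namespace CoopMDP

set_option linter.unusedSectionVars false

/-! ### Expectations over finite probability spaces -/

theorem toReal_le_one {Ω : Type*} (μ : PMF Ω) (x : Ω) : (μ x).toReal ≤ 1 :=
  ENNReal.toReal_le_of_le_ofReal zero_le_one (by simpa using μ.coe_le_one x)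

section Expectation

variable {Ω Ω' : Type*} [Fintype Ω] [Fintype Ω']

/-- The expectation of a real function under a law on a finite type. -/
noncomputable def expect (μ : PMF Ω) (f : Ω → ℝ) : ℝ := ∑ x, (μ x).toReal * f x

theorem sum_toReal_eq_one (μ : PMF Ω) : ∑ x, (μ x).toReal = 1 := by
  rw [← ENNReal.toReal_sum fun x _ => μ.apply_ne_top x,
    ← tsum_fintype (L := SummationFilter.unconditional _), μ.tsum_coe, ENNReal.toReal_one]

theorem expect_const (μ : PMF Ω) (r : ℝ) : expect μ (fun _ => r) = r := by
  rw [expect, ← Finset.sum_mul, sum_toReal_eq_one, one_mul]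

theorem expect_mono (μ : PMF Ω) {f g : Ω → ℝ} (h : ∀ x, f x ≤ g x) : expect μ f ≤ expect μ g :=
  Finset.sum_le_sum fun x _ => mul_le_mul_of_nonneg_left (h x) ENNReal.toReal_nonneg

theorem expect_le_of_le (μ : PMF Ω) {f : Ω → ℝ} {r : ℝ} (h : ∀ x, f x ≤ r) : expect μ f ≤ r :=
  (expect_mono μ h).trans_eq (expect_const μ r)

theorem expect_nonneg (μ : PMF Ω) {f : Ω → ℝ} (h : ∀ x, 0 ≤ f x) : 0 ≤ expect μ f :=
  Finset.sum_nonneg fun x _ => mul_nonneg ENNReal.toReal_nonneg (h x)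

theorem expect_add (μ : PMF Ω) (f g : Ω → ℝ) :
    expect μ (fun x => f x + g x) = expect μ f + expect μ g := by
  simp only [expect, mul_add, Finset.sum_add_distrib]

theorem expect_sub (μ : PMF Ω) (f g : Ω → ℝ) :
    expect μ (fun x => f x - g x) = expect μ f - expect μ g := by
  simp only [expect, mul_sub, Finset.sum_sub_distrib]

theorem expect_const_mul (μ : PMF Ω) (r : ℝ) (f : Ω → ℝ) :
    expect μ (fun x => r * f x) = r * expect μ f := by
  simp only [expect, Finset.mul_sum]
  exact Finset.sum_congr rfl fun x _ => by ring

theorem expect_mul_const (μ : PMF Ω) (f : Ω → ℝ) (r : ℝ) :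
    expect μ (fun x => f x * r) = expect μ f * r := by
  simp only [expect, Finset.sum_mul, mul_assoc]

theorem expect_sum {ι : Type*} (μ : PMF Ω) (s : Finset ι) (f : ι → Ω → ℝ) :
    expect μ (fun x => ∑ i ∈ s, f i x) = ∑ i ∈ s, expect μ (f i) := by
  simp only [expect, Finset.mul_sum]
  exact Finset.sum_comm

theorem expect_pure (x : Ω) (f : Ω → ℝ) : expect (PMF.pure x) f = f x := by
  classical
  simp [expect, PMF.pure_apply, apply_ite ENNReal.toReal]

theorem expect_bind (μ : PMF Ω) (κ : Ω → PMF Ω') (f : Ω' → ℝ) :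
    expect (μ.bind κ) f = expect μ fun x => expect (κ x) f := by
  simp only [expect, PMF.bind_apply, tsum_fintype]
  simp_rw [ENNReal.toReal_sum fun x (_ : x ∈ Finset.univ) =>
    ENNReal.mul_ne_top (μ.apply_ne_top x) ((κ x).apply_ne_top _), ENNReal.toReal_mul,
    Finset.sum_mul, Finset.mul_sum]
  rw [Finset.sum_comm]
  exact Finset.sum_congr rfl fun x _ => Finset.sum_congr rfl fun y _ => by ring

theorem expect_map (μ : PMF Ω) (g : Ω → Ω') (f : Ω' → ℝ) :
    expect (μ.map g) f = expect μ fun x => f (g x) := by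
  rw [PMF.map, expect_bind]
  simp only [Function.comp_apply, expect_pure]

theorem expect_ite_eq [DecidableEq Ω] (μ : PMF Ω) (x : Ω) :
    expect μ (fun y => if y = x then 1 else 0) = (μ x).toReal := by
  simp [expect]

open scoped Classical in
theorem toReal_toOuterMeasure (μ : PMF Ω) (s : Set Ω) :
    (μ.toOuterMeasure s).toReal = expect μ fun x => if x ∈ s then 1 else 0 := by
  rw [PMF.toOuterMeasure_apply_fintype, ENNReal.toReal_sum]
  · refine Finset.sum_congr rfl fun x _ => ?_
    by_cases hx : x ∈ s <;> simp [hx]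
  · intro x _
    by_cases hx : x ∈ s <;> simp [hx, μ.apply_ne_top]

end Expectation

section Product

variable {ι : Type*} [Fintype ι] [DecidableEq ι] {α : ι → Type*} [∀ i, Fintype (α i)]

theorem toReal_piPMF_apply (p : ∀ i, PMF (α i)) (f : ∀ i, α i) :
    (piPMF p f).toReal = ∏ i, (p i (f i)).toReal := by
  rw [piPMF, PMF.ofFintype_apply, ENNReal.toReal_prod]

theorem expect_piPMF_prod (p : ∀ i, PMF (α i)) (φ : ∀ i, α i → ℝ) :
    expect (piPMF p) (fun f => ∏ i, φ i (f i)) = ∏ i, expect (p i) (φ i) := by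
  simp only [expect, toReal_piPMF_apply, ← Finset.prod_mul_distrib]
  rw [Fintype.prod_sum]

/-- Replacing one coordinate by an independent copy preserves the joint law of the family and of
the copy, with the roles of the old and the new coordinate exchanged. -/
theorem expect_piPMF_swap (p : ∀ i, PMF (α i)) (i : ι) (F : (∀ i, α i) → α i → ℝ) :
    expect (piPMF p) (fun f => expect (p i) fun x => F (Function.update f i x) (f i)) =
      expect (piPMF p) (fun f => expect (p i) fun x => F f x) := by
  simp only [expect, Finset.mul_sum]
  rw [← Fintype.sum_prod_type', ← Fintype.sum_prod_type']
  let e : ((∀ i, α i) × α i) ≃ ((∀ i, α i) × α i) :=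
    { toFun := fun z => (Function.update z.1 i z.2, z.1 i)
      invFun := fun z => (Function.update z.1 i z.2, z.1 i)
      left_inv := fun z => by simp
      right_inv := fun z => by simp }
  refine Fintype.sum_equiv e _ _ fun z => ?_
  have key : (piPMF p z.1).toReal * (p i z.2).toReal =
      (piPMF p (e z).1).toReal * (p i (e z).2).toReal := by
    simp only [toReal_piPMF_apply, e, Equiv.coe_fn_mk]
    rw [Fintype.prod_eq_mul_prod_compl i, Fintype.prod_eq_mul_prod_compl i
      (fun j => (p j (Function.update z.1 i z.2 j)).toReal)]
    have : ∏ j ∈ ({i}ᶜ : Finset ι), (p j (Function.update z.1 i z.2 j)).toReal =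
        ∏ j ∈ ({i}ᶜ : Finset ι), (p j (z.1 j)).toReal :=
      Finset.prod_congr rfl fun j hj => by
        rw [Function.update_of_ne (by simpa using hj)]
    rw [this, Function.update_self]
    ring
  rw [← mul_assoc, key, mul_assoc]
  rfl

/-- A function that ignores the coordinate `i` is independent of this coordinate. -/
theorem expect_piPMF_mul (p : ∀ i, PMF (α i)) (i : ι) (G : (∀ i, α i) → ℝ) (φ : α i → ℝ)
    (hG : ∀ f x, G (Function.update f i x) = G f) :
    expect (piPMF p) (fun f => G f * φ (f i)) = expect (piPMF p) G * expect (p i) φ := by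
  have h := expect_piPMF_swap p i fun f x => G f * φ x
  simp only [hG, expect_const, expect_const_mul, expect_mul_const] at h
  exact h

theorem expect_piPMF_apply (p : ∀ i, PMF (α i)) (i : ι) (φ : α i → ℝ) :
    expect (piPMF p) (fun f => φ (f i)) = expect (p i) φ := by
  simpa [expect_const] using expect_piPMF_mul p i (fun _ => 1) φ fun _ _ => rfl

end Product

/-! ### Episodes with non-fresh randomness and reachability -/

section Rollouts

variable {S : Type*} {A : Type*} {H : ℕ}

/-- The state at step `h` of a single agent with realized transitions `σ` and action table `β`. -/
def singleState (M : EpisodicMDP S A H) (σ : Fin H → S → A → S) (β : Fin H → S → A) : ℕ → S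
  | 0 => M.init
  | h + 1 =>
    if hh : h < H then
      σ ⟨h, hh⟩ (singleState M σ β h) (β ⟨h, hh⟩ (singleState M σ β h))
    else singleState M σ β h

theorem agentState_eq_singleState (M : EpisodicMDP S A H) {m : ℕ} (ω : Rollout S A H m)
    (v : Fin m) (h : ℕ) : agentState M ω v h = singleState M ω.1 (ω.2 v) h := by
  induction h with
  | zero => rfl
  | succ h ih => simp only [agentState, singleState, ih]

theorem singleState_update_transition (M : EpisodicMDP S A H) (σ : Fin H → S → A → S)
    (β : Fin H → S → A) (i : Fin H) (x : S → A → S) (h : ℕ) (hi : h ≤ i) :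
    singleState M (Function.update σ i x) β h = singleState M σ β h := by
  induction h with
  | zero => rfl
  | succ h ih =>
    have hne : ∀ hh : h < H, (⟨h, hh⟩ : Fin H) ≠ i := fun hh e => by
      rw [← e] at hi; exact absurd hi (by simp)
    simp only [singleState, ih (by omega), Function.update_of_ne (hne _)]

theorem singleState_update_action (M : EpisodicMDP S A H) (σ : Fin H → S → A → S)
    (β : Fin H → S → A) (i : Fin H) (x : S → A) (h : ℕ) (hi : h ≤ i) :
    singleState M σ (Function.update β i x) h = singleState M σ β h := by
  induction h with
  | zero => rfl
  | succ h ih =>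
    have hne : ∀ hh : h < H, (⟨h, hh⟩ : Fin H) ≠ i := fun hh e => by
      rw [← e] at hi; exact absurd hi (by simp)
    simp only [singleState, ih (by omega), Function.update_of_ne (hne _)]

variable [Fintype S] [DecidableEq S] [Fintype A]

/-- The law of the action table of one agent that plays `π`. -/
noncomputable def actionLaw (π : Policy S A H) : PMF (Fin H → S → A) :=
  piPMF fun h => piPMF fun s => π h s

/-- The probability, given the realized transitions, that one agent is in state `s` at step `h`. -/
noncomputable def condStateProb (M : EpisodicMDP S A H) (π : Policy S A H)
    (σ : Fin H → S → A → S) (h : ℕ) (s : S) : ℝ :=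
  expect (actionLaw π) fun β => if singleState M σ β h = s then 1 else 0

theorem condStateProb_nonneg (M : EpisodicMDP S A H) (π : Policy S A H)
    (σ : Fin H → S → A → S) (h : ℕ) (s : S) : 0 ≤ condStateProb M π σ h s :=
  expect_nonneg _ fun β => by split_ifs <;> norm_num

theorem condStateProb_le_one (M : EpisodicMDP S A H) (π : Policy S A H)
    (σ : Fin H → S → A → S) (h : ℕ) (s : S) : condStateProb M π σ h s ≤ 1 :=
  expect_le_of_le _ fun β => by split_ifs <;> norm_num

theorem stateLaw_succ_toReal (M : EpisodicMDP S A H) (π : Policy S A H) (h : ℕ) (hh : h < H)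
    (s' : S) : (stateLaw M π (h + 1) s').toReal =
      ∑ s, (stateLaw M π h s).toReal *
        ∑ a, (π ⟨h, hh⟩ s a).toReal * (M.trans ⟨h, hh⟩ s a s').toReal := by
  rw [← expect_ite_eq, stateLaw, dif_pos hh, expect_bind]
  refine Finset.sum_congr rfl fun s _ => ?_
  change _ * expect ((π ⟨h, hh⟩ s).bind fun a => M.trans ⟨h, hh⟩ s a) _ = _
  rw [expect_bind]
  simp only [expect_ite_eq]
  rfl

variable [DecidableEq A]

/-- The law of the realized transitions of an episode. -/
noncomputable def transitionLaw (M : EpisodicMDP S A H) : PMF (Fin H → S → A → S) :=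
  piPMF fun h => piPMF fun s => piPMF fun a => M.trans h s a

theorem expect_rolloutLaw (M : EpisodicMDP S A H) (π : Policy S A H) (m : ℕ)
    (F : Rollout S A H m → ℝ) :
    expect (rolloutLaw M π m) F = expect (transitionLaw M) fun σ =>
      expect (piPMF fun _ : Fin m => actionLaw π) fun α => F (σ, α) := by
  rw [rolloutLaw, expect_bind]
  simp only [expect_map]
  rfl

/-- The action at step `h` is independent of the state at step `h`, which depends on earlier
entries of the action table only. -/
theorem expect_actionLaw_visit (M : EpisodicMDP S A H) (π : Policy S A H)
    (σ : Fin H → S → A → S) (h : Fin H) (s : S) (a : A) :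
    expect (actionLaw π) (fun β => (if singleState M σ β h = s then 1 else 0) *
        if β h s = a then 1 else 0) =
      condStateProb M π σ h s * (π h s a).toReal := by
  have hπ : expect (piPMF fun s => π h s) (fun b => if b s = a then 1 else 0) =
      (π h s a).toReal :=
    (expect_piPMF_apply (fun s => π h s) s fun x => if x = a then 1 else 0).trans
      (expect_ite_eq _ _)
  rw [actionLaw, expect_piPMF_mul _ h (fun β => if singleState M σ β h = s then (1 : ℝ) else 0)
    (fun b => if b s = a then 1 else 0), hπ]
  · rfl
  · intro β x
    simp only [singleState_update_action M σ β h x h le_rfl]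

/-- The law of the next state of one agent, given the realized transitions. -/
theorem condStateProb_succ (M : EpisodicMDP S A H) (π : Policy S A H) (σ : Fin H → S → A → S)
    (h : Fin H) (s' : S) : condStateProb M π σ (h + 1) s' =
      ∑ s, ∑ a, condStateProb M π σ h s * (π h s a).toReal *
        if σ h s a = s' then 1 else 0 := by
  simp only [← expect_actionLaw_visit, ← expect_mul_const, ← expect_sum]
  refine congrArg _ (funext fun β => ?_)
  rw [Finset.sum_eq_single (singleState M σ β h), Finset.sum_eq_single
    (β h (singleState M σ β h))]
  · simp [singleState]
  · intro a _ ha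
    simp [ha.symm]
  · simp
  · intro s _ hs
    simp [hs.symm]
  · simp

/-- Averaging over the realized transitions gives the Markov chain of a single agent, since the
transition drawn at step `h` is independent of the state at step `h`. -/
theorem expect_condStateProb (M : EpisodicMDP S A H) (π : Policy S A H) (h : ℕ) (hH : h ≤ H)
    (s : S) : expect (transitionLaw M) (fun σ => condStateProb M π σ h s) =
      (stateLaw M π h s).toReal := by
  classical
  induction h generalizing s with
  | zero =>
    simp [condStateProb, singleState, expect_const, stateLaw, PMF.pure_apply, eq_comm,
      apply_ite ENNReal.toReal]
  | succ h ih =>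
    have hh : h < H := hH
    have hs := fun σ => condStateProb_succ M π σ ⟨h, hh⟩ s
    simp only [] at hs
    simp only [hs, expect_sum, stateLaw_succ_toReal M π h hh, Finset.mul_sum]
    refine Finset.sum_congr rfl fun s₀ _ => Finset.sum_congr rfl fun a _ => ?_
    have ht : expect (piPMF fun s => piPMF fun a => M.trans ⟨h, hh⟩ s a)
        (fun x => if x s₀ a = s then 1 else 0) = (M.trans ⟨h, hh⟩ s₀ a s).toReal :=
      ((expect_piPMF_apply (fun s => piPMF fun a => M.trans ⟨h, hh⟩ s a) s₀
        fun x => if x a = s then 1 else 0).trans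
        (expect_piPMF_apply (fun a => M.trans ⟨h, hh⟩ s₀ a) a
          fun x => if x = s then 1 else 0)).trans (expect_ite_eq _ _)
    rw [transitionLaw, expect_piPMF_mul _ ⟨h, hh⟩
      (fun σ => condStateProb M π σ h s₀ * (π ⟨h, hh⟩ s₀ a).toReal)
      (fun x => if x s₀ a = s then 1 else 0), expect_mul_const, ht, mul_assoc]
    · congr 1
      exact ih hh.le s₀
    · intro σ x
      simp only [condStateProb, singleState_update_transition M σ _ ⟨h, hh⟩ x h le_rfl]

theorem occupancy_eq_expect (M : EpisodicMDP S A H) (π : Policy S A H) (h : Fin H) (s : S)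
    (a : A) : occupancy M π h s a =
      expect (transitionLaw M) fun σ => condStateProb M π σ h s * (π h s a).toReal := by
  rw [expect_mul_const, expect_condStateProb M π h h.isLt.le, occupancy]

open scoped Classical in
theorem reachProb_eq_expect_visited (M : EpisodicMDP S A H) (π : Policy S A H) (m : ℕ)
    (h : Fin H) (s : S) (a : A) : reachProb M π m h s a =
      expect (rolloutLaw M π m) fun ω => if Visited M ω h s a then 1 else 0 := by
  rw [reachProb, toReal_toOuterMeasure]
  rfl

/-- Given the realized transitions the `m` agents are independent. -/
theorem reachProb_eq_expect (M : EpisodicMDP S A H) (π : Policy S A H) (m : ℕ)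
    (h : Fin H) (s : S) (a : A) : reachProb M π m h s a =
      expect (transitionLaw M) fun σ =>
        1 - (1 - condStateProb M π σ h s * (π h s a).toReal) ^ m := by
  classical
  rw [reachProb_eq_expect_visited, expect_rolloutLaw]
  refine congrArg _ (funext fun σ => ?_)
  have hv : ∀ α : Fin m → Fin H → S → A,
      (if Visited M (σ, α) h s a then (1 : ℝ) else 0) =
        1 - ∏ v, (1 - (if singleState M σ (α v) h = s then 1 else 0) *
          if α v h s = a then 1 else 0) := by
    intro α
    by_cases hV : Visited M (σ, α) h s a
    · obtain ⟨v, hv₁, hv₂⟩ := hV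
      rw [if_pos ⟨v, hv₁, hv₂⟩, Finset.prod_eq_zero (Finset.mem_univ v), sub_zero]
      rw [hv₁] at hv₂
      rw [agentState_eq_singleState] at hv₁
      have hv₁' : singleState M σ (α v) h = s := hv₁
      have hv₂' : α v h s = a := hv₂
      simp [hv₁', hv₂']
    · rw [if_neg hV, Finset.prod_eq_one, sub_self]
      intro v _
      by_cases h₁ : singleState M σ (α v) h = s
      · have h₂ : α v h s ≠ a := fun h₂ => hV ⟨v, by
          rw [agentState_eq_singleState]; exact h₁, by
          rw [agentState_eq_singleState]; simp only [h₁, h₂]⟩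
        simp [h₂]
      · simp [h₁]
  simp only [hv]
  rw [expect_sub, expect_const, expect_piPMF_prod (fun _ : Fin m => actionLaw π)
    fun _ β => 1 - (if singleState M σ β h = s then 1 else 0) * if β h s = a then 1 else 0]
  simp only [expect_sub, expect_const, expect_actionLaw_visit, Finset.prod_const,
    Finset.card_univ, Fintype.card_fin]

/-- If each of `m` independent agents succeeds with probability `x * p`, the probability that some
agent succeeds is at least `m x p / (1 + m x p)` by Bernoulli's inequality. -/
theorem mul_le_inv_add_mul_one_sub_pow {x p : ℝ} (hx₀ : 0 ≤ x) (hx₁ : x ≤ 1) (hp₀ : 0 ≤ p)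
    (hp₁ : p ≤ 1) {m : ℕ} (hm : 0 < m) :
    x * p ≤ (1 / (m : ℝ) + p) * (1 - (1 - x * p) ^ m) := by
  have hm' : (0 : ℝ) < m := Nat.cast_pos.2 hm
  set y := x * p with hy
  have hy₀ : 0 ≤ y := mul_nonneg hx₀ hp₀
  have hyp : y ≤ p := mul_le_of_le_one_left hp₀ hx₁
  have hpow : 0 ≤ (1 - y) ^ m := pow_nonneg (by linarith) m
  have h₁ : (1 - y) ^ m * (1 + m * y) ≤ 1 := calc
    (1 - y) ^ m * (1 + m * y) ≤ (1 - y) ^ m * (1 + y) ^ m :=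
      mul_le_mul_of_nonneg_left (one_add_mul_le_pow (by linarith) m) hpow
    _ = (1 - y ^ 2) ^ m := by rw [← mul_pow]; ring
    _ ≤ 1 := pow_le_one₀ (by nlinarith) (by nlinarith)
  have h₂ : (1 - y) ^ m ≤ 1 := pow_le_one₀ (by linarith) (by linarith)
  calc y ≤ (1 / (m : ℝ) + y) * (1 - (1 - y) ^ m) := by
        have : (1 / (m : ℝ) + y) * (1 - (1 - y) ^ m) - y =
            (1 - (1 - y) ^ m * (1 + m * y)) / m := by field_simp; ring
        have h₃ : 0 ≤ (1 - (1 - y) ^ m * (1 + m * y)) / m :=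
          div_nonneg (by linarith) hm'.le
        linarith
    _ ≤ _ := mul_le_mul_of_nonneg_right (by linarith) (by linarith)

/-- The reachability ratio under non-fresh randomness. -/
theorem occupancy_le_mul_reachProb (M : EpisodicMDP S A H) (π : Policy S A H) {m : ℕ}
    (hm : 0 < m) (h : Fin H) (s : S) (a : A) :
    occupancy M π h s a ≤ (1 / (m : ℝ) + (π h s a).toReal) * reachProb M π m h s a := by
  rw [occupancy_eq_expect, reachProb_eq_expect, ← expect_const_mul]
  exact expect_mono _ fun σ => mul_le_inv_add_mul_one_sub_pow (condStateProb_nonneg ..)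
    (condStateProb_le_one ..) ENNReal.toReal_nonneg (toReal_le_one _ _) hm

theorem reachProb_nonneg (M : EpisodicMDP S A H) (π : Policy S A H) (m : ℕ)
    (h : Fin H) (s : S) (a : A) : 0 ≤ reachProb M π m h s a := ENNReal.toReal_nonneg

open scoped Classical in
/-- At each step, `m` agents visit at most `m` state-action pairs. -/
theorem sum_visited_le {M : EpisodicMDP S A H} {m : ℕ} (ω : Rollout S A H m) (h : Fin H) :
    ∑ s, ∑ a, (if Visited M ω h s a then (1 : ℝ) else 0) ≤ m := by
  calc ∑ s, ∑ a, (if Visited M ω h s a then (1 : ℝ) else 0)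
      ≤ ∑ s, ∑ a, ∑ v : Fin m,
          if agentState M ω v h = s then
            if ω.2 v h (agentState M ω v h) = a then (1 : ℝ) else 0 else 0 := by
        refine Finset.sum_le_sum fun s _ => Finset.sum_le_sum fun a _ => ?_
        have hnn : ∀ v ∈ Finset.univ, (0 : ℝ) ≤ if agentState M ω v h = s then
            if ω.2 v h (agentState M ω v h) = a then (1 : ℝ) else 0 else 0 := fun v _ => by
          split_ifs <;> norm_num
        split_ifs with hV
        · obtain ⟨v, hv₁, hv₂⟩ := hV
          refine le_trans ?_ (Finset.single_le_sum hnn (Finset.mem_univ v))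
          rw [if_pos hv₁, if_pos hv₂]
        · exact Finset.sum_nonneg hnn
    _ = m := by
        have h₁ : ∀ s, (∑ a, ∑ v : Fin m, if agentState M ω v h = s then
            if ω.2 v h (agentState M ω v h) = a then (1 : ℝ) else 0 else 0) =
            ∑ v : Fin m, if agentState M ω v h = s then (1 : ℝ) else 0 := fun s => by
          rw [Finset.sum_comm]
          exact Finset.sum_congr rfl fun v _ => by split_ifs <;> simp
        rw [Finset.sum_congr rfl fun s _ => h₁ s, Finset.sum_comm]
        simp

end Rollouts

/-! ### Entropic objectives on convex sets -/

section Entropy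

variable {ι : Type*} [Fintype ι]

/-- The objective `∑ b q + q log q`: a linear cost with the entropic regularizer. -/
noncomputable def entObj (b q : ι → ℝ) : ℝ := ∑ i, (b i * q i + q i * Real.log (q i))

/-- The relative entropy `∑ u log (u / w)` as a real number; it is only meaningful when `u`
vanishes wherever `w` does. -/
noncomputable def relEnt (u w : ι → ℝ) : ℝ := ∑ i, u i * Real.log (u i / w i)

theorem mul_log_div_eq {x y : ℝ} (h : y = 0 → x = 0) :
    x * Real.log (x / y) = x * Real.log x - x * Real.log y := by
  by_cases hx : x = 0
  · simp [hx]
  · rw [Real.log_div hx (mt h hx)]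
    ring

theorem sub_le_mul_log_div {x y : ℝ} (hx : 0 ≤ x) (hy : 0 ≤ y) (h : y = 0 → x = 0) :
    x - y ≤ x * Real.log (x / y) := by
  rcases hx.eq_or_lt with rfl | hx'
  · simpa using hy
  · have hy' : 0 < y := lt_of_le_of_ne hy fun e => hx'.ne' (h e.symm)
    have := mul_le_mul_of_nonneg_left (Real.one_sub_inv_le_log_of_pos (div_pos hx' hy')) hx
    refine le_trans (le_of_eq ?_) this
    field_simp

theorem relEnt_nonneg {u w : ι → ℝ} (hu : ∀ i, 0 ≤ u i) (hw : ∀ i, 0 ≤ w i)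
    (h : ∀ i, w i = 0 → u i = 0) (hs : ∑ i, u i = ∑ i, w i) : 0 ≤ relEnt u w := by
  have : ∑ i, (u i - w i) ≤ relEnt u w :=
    Finset.sum_le_sum fun i _ => sub_le_mul_log_div (hu i) (hw i) (h i)
  rwa [Finset.sum_sub_distrib, hs, sub_self] at this

/-- The defect of convexity of the entropic objective is a mixture of relative entropies. -/
theorem entObj_mix (b : ι → ℝ) {u v : ι → ℝ} (hu : ∀ i, 0 ≤ u i) (hv : ∀ i, 0 ≤ v i) {t : ℝ}
    (ht₀ : 0 < t) (ht₁ : t < 1) :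
    (1 - t) * entObj b v + t * entObj b u - entObj b (fun i => (1 - t) * v i + t * u i) =
      (1 - t) * relEnt v (fun i => (1 - t) * v i + t * u i) +
        t * relEnt u (fun i => (1 - t) * v i + t * u i) := by
  simp only [entObj, relEnt, Finset.mul_sum, ← Finset.sum_add_distrib, ← Finset.sum_sub_distrib]
  refine Finset.sum_congr rfl fun i _ => ?_
  have h₁ : 0 ≤ (1 - t) * v i := mul_nonneg (by linarith) (hv i)
  have h₂ : 0 ≤ t * u i := mul_nonneg ht₀.le (hu i)
  rw [mul_log_div_eq (x := v i), mul_log_div_eq (x := u i)]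
  · ring
  · intro h
    have : t * u i = 0 := by linarith
    exact (mul_eq_zero.1 this).resolve_left ht₀.ne'
  · intro h
    have : (1 - t) * v i = 0 := by linarith
    exact (mul_eq_zero.1 this).resolve_left (by linarith)

variable {D : Set (ι → ℝ)} {b v : ι → ℝ} {r : ℝ}

/-- A minimizer `v` beats `u` by at least the relative entropy of `u` with respect to each point of
the open segment from `v` to `u`. -/
theorem relEnt_segment_le_of_isMinOn (hD : Convex ℝ D) (hnn : ∀ u ∈ D, ∀ i, 0 ≤ u i)
    (hsum : ∀ u ∈ D, ∑ i, u i = r) (hv : v ∈ D) (hmin : IsMinOn (entObj b) D v)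
    {u : ι → ℝ} (hu : u ∈ D) {t : ℝ} (ht₀ : 0 < t) (ht₁ : t < 1) :
    relEnt u (fun i => (1 - t) * v i + t * u i) ≤ entObj b u - entObj b v := by
  have hw : (fun i => (1 - t) * v i + t * u i) ∈ D :=
    hD hv hu (by linarith) ht₀.le (by ring)
  have h₁ := entObj_mix b (hnn u hu) (hnn v hv) ht₀ ht₁
  have h₂ : entObj b v ≤ entObj b fun i => (1 - t) * v i + t * u i := hmin hw
  have h₃ : 0 ≤ relEnt v fun i => (1 - t) * v i + t * u i := by
    refine relEnt_nonneg (hnn v hv) (hnn _ hw) (fun i hi => ?_) ((hsum v hv).trans (hsum _ hw).symm)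
    have h₄ : 0 ≤ (1 - t) * v i := mul_nonneg (by linarith) (hnn v hv i)
    have h₅ : 0 ≤ t * u i := mul_nonneg ht₀.le (hnn u hu i)
    have : (1 - t) * v i = 0 := by linarith
    exact (mul_eq_zero.1 this).resolve_left (by linarith)
  have h₆ : 0 ≤ (1 - t) * relEnt v fun i => (1 - t) * v i + t * u i :=
    mul_nonneg (by linarith) h₃
  have h₇ : t * relEnt u (fun i => (1 - t) * v i + t * u i) ≤ t * (entObj b u - entObj b v) := by
    linarith
  exact le_of_mul_le_mul_left h₇ ht₀

/-- A minimizer has full support: along the segment to a point `u` with `u i > 0 = v i` the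
relative entropy of `u` would contain the unbounded term `u i * log (1 / t)`. -/
theorem eq_zero_of_isMinOn (hD : Convex ℝ D) (hnn : ∀ u ∈ D, ∀ i, 0 ≤ u i)
    (hsum : ∀ u ∈ D, ∑ i, u i = r) (hv : v ∈ D) (hmin : IsMinOn (entObj b) D v)
    {u : ι → ℝ} (hu : u ∈ D) {i : ι} (hi : v i = 0) : u i = 0 := by
  classical
  by_contra hne
  have hpos : 0 < u i := lt_of_le_of_ne (hnn u hu i) (Ne.symm hne)
  have hr : 0 ≤ r := (hsum u hu) ▸ Finset.sum_nonneg fun j _ => hnn u hu j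
  -- at this `t` the singular term exceeds the gap of the objective plus the mass `r`
  set z : ℝ := (|entObj b u - entObj b v| + r + 1) / u i with hz
  have hz₀ : 0 < z := div_pos (by positivity) hpos
  have ht₁ : Real.exp (-z) < 1 := Real.exp_lt_one_iff.2 (by linarith)
  have key := relEnt_segment_le_of_isMinOn hD hnn hsum hv hmin hu (Real.exp_pos (-z)) ht₁
  set w : ι → ℝ := fun j => (1 - Real.exp (-z)) * v j + Real.exp (-z) * u j with hw
  have hwD : w ∈ D := hD hv hu (by linarith) (Real.exp_pos _).le (by ring)
  have hterm : u i * Real.log (u i / w i) = u i * z := by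
    have : u i / w i = Real.exp z := by
      rw [hw, Real.exp_neg]
      simp only [hi, mul_zero, zero_add]
      field_simp
    rw [this, Real.log_exp]
  have hrest : ∑ j ∈ {i}ᶜ, (u j - w j) ≤ ∑ j ∈ {i}ᶜ, u j * Real.log (u j / w j) := by
    refine Finset.sum_le_sum fun j _ => sub_le_mul_log_div (hnn u hu j) (hnn w hwD j) fun hj => ?_
    have h₄ : 0 ≤ (1 - Real.exp (-z)) * v j := mul_nonneg (by linarith) (hnn v hv j)
    have h₅ : 0 ≤ Real.exp (-z) * u j := mul_nonneg (Real.exp_pos _).le (hnn u hu j)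
    have : Real.exp (-z) * u j = 0 := by
      have : (1 - Real.exp (-z)) * v j + Real.exp (-z) * u j = 0 := hj
      linarith
    exact (mul_eq_zero.1 this).resolve_left (Real.exp_pos _).ne'
  have hlow : -r ≤ ∑ j ∈ {i}ᶜ, (u j - w j) := by
    rw [Finset.sum_sub_distrib]
    have h₁ : 0 ≤ ∑ j ∈ {i}ᶜ, u j := Finset.sum_nonneg fun j _ => hnn u hu j
    have h₂ : ∑ j ∈ {i}ᶜ, w j ≤ ∑ j, w j :=
      Finset.sum_le_sum_of_subset_of_nonneg (Finset.subset_univ _) fun j _ _ => hnn w hwD j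
    rw [hsum w hwD] at h₂
    linarith
  rw [relEnt, Fintype.sum_eq_add_sum_compl i, hterm] at key
  have huz : u i * z = |entObj b u - entObj b v| + r + 1 := by
    rw [hz]; field_simp
  linarith [le_abs_self (entObj b u - entObj b v)]

/-- The generalized Pythagorean inequality for a minimizer of the entropic objective. -/
theorem relEnt_le_of_isMinOn (hD : Convex ℝ D) (hnn : ∀ u ∈ D, ∀ i, 0 ≤ u i)
    (hsum : ∀ u ∈ D, ∑ i, u i = r) (hv : v ∈ D) (hmin : IsMinOn (entObj b) D v)
    {u : ι → ℝ} (hu : u ∈ D) : relEnt u v ≤ entObj b u - entObj b v := by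
  have hlim : Filter.Tendsto (fun t : ℝ => relEnt u fun i => (1 - t) * v i + t * u i)
      (nhdsWithin 0 (Set.Ioi 0)) (nhds (relEnt u v)) := by
    refine Filter.Tendsto.mono_left ?_ nhdsWithin_le_nhds
    refine tendsto_finsetSum _ fun i _ => ?_
    by_cases hi : v i = 0
    · simp [eq_zero_of_isMinOn hD hnn hsum hv hmin hu hi]
    by_cases hui : u i = 0
    · simp [hui]
    · have hc : ContinuousAt (fun t : ℝ => u i * Real.log (u i / ((1 - t) * v i + t * u i))) 0 := by
        refine continuousAt_const.mul (ContinuousAt.log (continuousAt_const.div (by fun_prop) ?_) ?_)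
        · simpa using hi
        · simpa using ⟨hui, hi⟩
      have := hc.tendsto
      simpa using this
  refine le_of_tendsto hlim ?_
  filter_upwards [Ioo_mem_nhdsGT (show (0 : ℝ) < 1 from one_pos)] with t ht
  exact relEnt_segment_le_of_isMinOn hD hnn hsum hv hmin hu ht.1 ht.2

theorem continuous_entObj (b : ι → ℝ) : Continuous (entObj b) := by
  refine continuous_finsetSum _ fun i _ => ?_
  exact (continuous_const.mul (continuous_apply i)).add
    (Real.continuous_mul_log.comp (continuous_apply i))

theorem exp_neg_le_quadratic {x : ℝ} (hx : 0 ≤ x) : Real.exp (-x) ≤ 1 - x + x ^ 2 := by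
  have h₁ : 1 + x ≤ Real.exp x := by linarith [Real.add_one_le_exp x]
  rw [Real.exp_neg]
  refine (inv_anti₀ (by linarith) h₁).trans ?_
  rw [inv_le_iff_one_le_mul₀ (by linarith)]
  nlinarith [pow_nonneg hx 3]

/-- One step of entropic mirror descent, from `v` with loss vector `x`: the linearized regret
against `u` is at most the decrease of the relative entropy plus a second-order term. -/
theorem mirror_descent_step {v' x : ι → ℝ} (hD : Convex ℝ D) (hnn : ∀ u ∈ D, ∀ i, 0 ≤ u i)
    (hsum : ∀ u ∈ D, ∑ i, u i = r) (hv : v ∈ D) (hsupp : ∀ u ∈ D, ∀ i, v i = 0 → u i = 0)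
    (hx : ∀ i, 0 ≤ x i) (hv' : v' ∈ D)
    (hmin : IsMinOn (entObj fun i => x i - Real.log (v i)) D v') {u : ι → ℝ} (hu : u ∈ D) :
    ∑ i, (v i - u i) * x i ≤ relEnt u v - relEnt u v' + ∑ i, v i * x i ^ 2 := by
  have hobj : ∀ w ∈ D, (entObj (fun i => x i - Real.log (v i)) w) =
      ∑ i, w i * x i + relEnt w v := fun w hw => by
    rw [entObj, relEnt, ← Finset.sum_add_distrib]
    refine Finset.sum_congr rfl fun i _ => ?_
    rw [mul_log_div_eq (hsupp w hw i)]
    ring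
  have h₁ := relEnt_le_of_isMinOn hD hnn hsum hv' hmin hu
  rw [hobj u hu, hobj v' hv'] at h₁
  have h₂ : ∑ i, (v i - v' i) * x i - relEnt v' v ≤ ∑ i, v i * x i ^ 2 := by
    have : ∑ i, ((v i - v' i) * x i - v' i * Real.log (v' i / v i) + (v' i - v i)) ≤
        ∑ i, v i * x i ^ 2 := by
      refine Finset.sum_le_sum fun i _ => ?_
      rcases (hnn v hv i).eq_or_lt with h0 | hpos
      · simp [← h0, hsupp v' hv' i h0.symm]
      · have h₃ := sub_le_mul_log_div (x := v' i) (y := v i * Real.exp (-x i)) (hnn v' hv' i)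
          (by positivity) fun e => absurd e (by positivity)
        have h₄ : v' i * Real.log (v' i / (v i * Real.exp (-x i))) =
            v' i * Real.log (v' i / v i) + v' i * x i := by
          by_cases h0 : v' i = 0
          · simp [h0]
          · rw [← div_div, Real.log_div (div_ne_zero h0 hpos.ne') (Real.exp_pos _).ne',
              Real.log_exp]
            ring
        have h₅ := mul_le_mul_of_nonneg_left (exp_neg_le_quadratic (hx i)) hpos.le
        rw [h₄] at h₃
        nlinarith
    rw [Finset.sum_add_distrib, Finset.sum_sub_distrib, Finset.sum_sub_distrib, hsum v hv,
      hsum v' hv', sub_self, add_zero] at this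
    exact this
  have h₃ : ∑ i, (v i - u i) * x i =
      ∑ i, (v i - v' i) * x i + (∑ i, v' i * x i - ∑ i, u i * x i) := by
    rw [← Finset.sum_sub_distrib, ← Finset.sum_add_distrib]
    exact Finset.sum_congr rfl fun i _ => by ring
  linarith

end Entropy

/-! ### Occupancy measures as a polytope -/

section Occupancy

variable {S : Type*} {A : Type*} {H : ℕ}
  [Fintype S] [DecidableEq S] [Fintype A]

/-- The mass that `q` sends to state `s` at step `h`: the initial mass at step `0`, and afterwards
the mass transported from the previous step. -/
noncomputable def inflow (M : EpisodicMDP S A H) (q : Tab S A H) : ℕ → S → ℝ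
  | 0, s => if s = M.init then 1 else 0
  | h + 1, s =>
    if hh : h < H then ∑ s', ∑ a, q ⟨h, hh⟩ s' a * (M.trans ⟨h, hh⟩ s' a s).toReal else 0

/-- The flow constraints that cut out the set of occupancy measures. -/
def IsFlow (M : EpisodicMDP S A H) (q : Tab S A H) : Prop :=
  (∀ h s a, 0 ≤ q h s a) ∧ ∀ (h : Fin H) s, ∑ a, q h s a = inflow M q h s

theorem sum_occupancy (M : EpisodicMDP S A H) (π : Policy S A H) (h : Fin H) (s : S) :
    ∑ a, occupancy M π h s a = (stateLaw M π h s).toReal := by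
  simp only [occupancy, ← Finset.mul_sum, sum_toReal_eq_one, mul_one]

theorem inflow_occupancy (M : EpisodicMDP S A H) (π : Policy S A H) (h : ℕ) (hH : h ≤ H)
    (s : S) : inflow M (occupancy M π) h s = (stateLaw M π h s).toReal := by
  cases h with
  | zero => simp [inflow, stateLaw, PMF.pure_apply, apply_ite ENNReal.toReal]
  | succ h =>
    have hh : h < H := hH
    rw [inflow, dif_pos hh, stateLaw_succ_toReal M π h hh]
    simp only [occupancy, Finset.mul_sum, mul_assoc]

theorem isFlow_occupancy (M : EpisodicMDP S A H) (π : Policy S A H) :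
    IsFlow M (occupancy M π) :=
  ⟨fun h s a => mul_nonneg ENNReal.toReal_nonneg ENNReal.toReal_nonneg, fun h s => by
    rw [sum_occupancy, inflow_occupancy M π h h.isLt.le]⟩

/-- Where the total mass vanishes both sides are `0`, so the uniform choice made there is
irrelevant. -/
theorem sum_mul_policyOf [Nonempty A] {q : Tab S A H} (hq : ∀ h s a, 0 ≤ q h s a) (h : Fin H)
    (s : S) (a : A) : (∑ a', q h s a') * (policyOf q h s a).toReal = q h s a := by
  have htot : ∑' a', ENNReal.ofReal (q h s a') = ENNReal.ofReal (∑ a', q h s a') := by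
    rw [tsum_fintype, ENNReal.ofReal_sum_of_nonneg fun a _ => hq h s a]
  have hsum : 0 ≤ ∑ a', q h s a' := Finset.sum_nonneg fun a _ => hq h s a
  unfold policyOf
  split_ifs with h0
  · rw [htot, ENNReal.ofReal_eq_zero] at h0
    have h1 : ∑ a', q h s a' = 0 := le_antisymm h0 hsum
    rw [h1, zero_mul, (Finset.sum_eq_zero_iff_of_nonneg fun a _ => hq h s a).1 h1 a
      (Finset.mem_univ a)]
  · rw [PMF.normalize_apply, htot, ENNReal.toReal_mul, ENNReal.toReal_inv,
      ENNReal.toReal_ofReal (hq h s a), ENNReal.toReal_ofReal hsum]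
    have : ∑ a', q h s a' ≠ 0 := fun e => h0 (by rw [htot, e, ENNReal.ofReal_zero])
    field_simp

/-- The policy extracted from a flow generates this flow. -/
theorem occupancy_policyOf [Nonempty A] {M : EpisodicMDP S A H} {q : Tab S A H}
    (hq : IsFlow M q) : occupancy M (policyOf q) = q := by
  have key : ∀ h : ℕ, h ≤ H → ∀ s, (stateLaw M (policyOf q) h s).toReal = inflow M q h s := by
    intro h
    induction h with
    | zero =>
      intro _ s
      rw [← inflow_occupancy M _ 0 (Nat.zero_le _)]
      rfl
    | succ h ih =>
      intro hH s
      have hh : h < H := hH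
      rw [stateLaw_succ_toReal M _ h hh, inflow, dif_pos hh]
      refine Finset.sum_congr rfl fun s' _ => ?_
      rw [Finset.mul_sum, ih hh.le, ← hq.2 ⟨h, hh⟩ s']
      exact Finset.sum_congr rfl fun a _ => by rw [← mul_assoc, sum_mul_policyOf hq.1]
  funext h s a
  rw [occupancy, key h h.isLt.le, ← hq.2 h s, sum_mul_policyOf hq.1]

theorem mem_occSet_iff [Nonempty A] {M : EpisodicMDP S A H} {q : Tab S A H} :
    q ∈ occSet M ↔ IsFlow M q :=
  ⟨fun ⟨π, hπ⟩ => hπ ▸ isFlow_occupancy M π, fun hq => ⟨policyOf q, occupancy_policyOf hq⟩⟩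

theorem inflow_mix (M : EpisodicMDP S A H) (q u : Tab S A H) {r t : ℝ} (hrt : r + t = 1) (h : ℕ)
    (s : S) : inflow M (r • q + t • u) h s = r * inflow M q h s + t * inflow M u h s := by
  cases h with
  | zero => simp only [inflow]; rw [← add_mul, hrt, one_mul]
  | succ h =>
    simp only [inflow]
    split_ifs with hh
    · simp only [Finset.mul_sum, ← Finset.sum_add_distrib, Pi.add_apply, Pi.smul_apply,
        smul_eq_mul]
      exact Finset.sum_congr rfl fun s' _ => Finset.sum_congr rfl fun a _ => by ring
    · simp

theorem convex_occSet [Nonempty A] (M : EpisodicMDP S A H) : Convex ℝ (occSet M) := by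
  intro q hq u hu r t hr ht hrt
  rw [mem_occSet_iff] at hq hu ⊢
  refine ⟨fun h s a => add_nonneg (mul_nonneg hr (hq.1 h s a)) (mul_nonneg ht (hu.1 h s a)),
    fun h s => ?_⟩
  rw [inflow_mix M q u hrt, ← hq.2, ← hu.2, Finset.mul_sum, Finset.mul_sum,
    ← Finset.sum_add_distrib]
  rfl

theorem nonneg_of_mem_occSet {M : EpisodicMDP S A H} {q : Tab S A H} (hq : q ∈ occSet M)
    (h : Fin H) (s : S) (a : A) : 0 ≤ q h s a := by
  obtain ⟨π, rfl⟩ := hq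
  exact (isFlow_occupancy M π).1 h s a

theorem sum_sum_of_mem_occSet {M : EpisodicMDP S A H} {q : Tab S A H} (hq : q ∈ occSet M)
    (h : Fin H) : ∑ s, ∑ a, q h s a = 1 := by
  obtain ⟨π, rfl⟩ := hq
  simp only [sum_occupancy, sum_toReal_eq_one]

theorem sum_of_mem_occSet {M : EpisodicMDP S A H} {q : Tab S A H} (hq : q ∈ occSet M) :
    ∑ h, ∑ s, ∑ a, q h s a = H := by
  simp [sum_sum_of_mem_occSet hq]

theorem le_one_of_mem_occSet {M : EpisodicMDP S A H} {q : Tab S A H} (hq : q ∈ occSet M)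
    (h : Fin H) (s : S) (a : A) : q h s a ≤ 1 := by
  obtain ⟨π, rfl⟩ := hq
  exact mul_le_one₀ (toReal_le_one _ _) ENNReal.toReal_nonneg (toReal_le_one _ _)

theorem continuous_inflow (M : EpisodicMDP S A H) (h : ℕ) (s : S) :
    Continuous fun q : Tab S A H => inflow M q h s := by
  cases h with
  | zero => simpa only [inflow] using continuous_const
  | succ h =>
    simp only [inflow]
    split_ifs with hh <;> fun_prop

theorem isCompact_occSet [Nonempty A] (M : EpisodicMDP S A H) : IsCompact (occSet M) := by
  have hbox : IsCompact (Set.pi Set.univ fun _ : Fin H => Set.pi Set.univ fun _ : S =>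
      Set.pi Set.univ fun _ : A => Set.Icc (0 : ℝ) 1) :=
    isCompact_univ_pi fun _ => isCompact_univ_pi fun _ => isCompact_univ_pi fun _ =>
      isCompact_Icc
  refine hbox.of_isClosed_subset ?_ fun q hq h _ s _ a _ =>
    ⟨nonneg_of_mem_occSet hq h s a, le_one_of_mem_occSet hq h s a⟩
  have : occSet M = (⋂ h, ⋂ s, ⋂ a, {q | 0 ≤ q h s a}) ∩
      ⋂ h : Fin H, ⋂ s, {q | ∑ a, q h s a = inflow M q h s} := Set.ext fun q => by
    simp only [Set.mem_inter_iff, Set.mem_iInter]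
    exact mem_occSet_iff
  rw [this]
  exact IsClosed.inter
    (isClosed_iInter fun h => isClosed_iInter fun s => isClosed_iInter fun a =>
      isClosed_le continuous_const (by fun_prop))
    (isClosed_iInter fun h => isClosed_iInter fun s =>
      isClosed_eq (by fun_prop) (continuous_inflow M h s))

theorem occSet_nonempty [Nonempty A] (M : EpisodicMDP S A H) : (occSet M).Nonempty :=
  ⟨_, fun _ _ => PMF.uniformOfFintype A, rfl⟩

/-- The expected cost of a policy is linear in its occupancy measure. -/
theorem value_eq_dot (M : EpisodicMDP S A H) (c : Tab S A H) (π : Policy S A H) :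
    value M c π 0 M.init = dot (occupancy M π) c := by
  set f : ℕ → ℝ := fun h => ∑ s, (stateLaw M π h s).toReal * value M c π h s with hf
  have h0 : f 0 = value M c π 0 M.init := by
    simp [hf, stateLaw, PMF.pure_apply, apply_ite ENNReal.toReal]
  have hH : f H = 0 := by
    refine Finset.sum_eq_zero fun s _ => ?_
    rw [value, dif_neg (lt_irrefl H), mul_zero]
  have hstep : ∀ h : Fin H, f h - f (h + 1) = ∑ s, ∑ a, occupancy M π h s a * c h s a := by
    intro h
    have e : f (h + 1) = ∑ s, ∑ a, occupancy M π h s a *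
        ∑ s', (M.trans h s a s').toReal * value M c π (h + 1) s' := by
      simp only [hf, stateLaw_succ_toReal M π h h.isLt, occupancy, Finset.mul_sum, Finset.sum_mul]
      rw [Finset.sum_comm]
      refine Finset.sum_congr rfl fun s _ => ?_
      rw [Finset.sum_comm]
      exact Finset.sum_congr rfl fun a _ => Finset.sum_congr rfl fun s' _ => by
        simp only [Fin.eta]; ring
    rw [e, sub_eq_iff_eq_add, ← Finset.sum_add_distrib]
    refine Finset.sum_congr rfl fun s _ => ?_
    rw [value, dif_pos h.isLt, ← Finset.sum_add_distrib, Finset.mul_sum]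
    exact Finset.sum_congr rfl fun a _ => by simp only [Fin.eta, occupancy]; ring
  rw [dot, ← Finset.sum_congr rfl fun h _ => hstep h,
    Fin.sum_univ_eq_sum_range (fun h => f h - f (h + 1)) H, Finset.sum_range_sub', hH, sub_zero,
    h0]

end Occupancy

/-! ### Mirror descent on occupancy measures -/

section MirrorDescent

variable {S : Type*} {A : Type*} {H : ℕ}
  [Fintype S] [DecidableEq S] [Fintype A] [DecidableEq A]

/-- A table read as a vector with a single index. -/
def flat (q : Tab S A H) : Fin H × S × A → ℝ := fun i => q i.1 i.2.1 i.2.2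

theorem sum_flat (F : Fin H × S × A → ℝ) : ∑ i, F i = ∑ h, ∑ s, ∑ a, F (h, s, a) := by
  simp only [Fintype.sum_prod_type]

theorem continuous_flat : Continuous (flat : Tab S A H → _) :=
  continuous_pi fun i => by unfold flat; fun_prop

theorem convex_flat_occSet [Nonempty A] (M : EpisodicMDP S A H) :
    Convex ℝ (flat '' occSet M) :=
  (convex_occSet M).is_linear_image ⟨fun _ _ => rfl, fun _ _ => rfl⟩

theorem nonneg_of_mem_flat_occSet {M : EpisodicMDP S A H} :
    ∀ u ∈ flat '' occSet M, ∀ i, 0 ≤ u i := by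
  rintro _ ⟨q, hq, rfl⟩ i
  exact nonneg_of_mem_occSet hq _ _ _

theorem sum_of_mem_flat_occSet {M : EpisodicMDP S A H} :
    ∀ u ∈ flat '' occSet M, ∑ i, u i = (H : ℝ) := by
  rintro _ ⟨q, hq, rfl⟩
  rw [sum_flat]
  exact sum_of_mem_occSet hq

theorem exists_isMinOn_entObj [Nonempty A] (M : EpisodicMDP S A H) (b : Fin H × S × A → ℝ) :
    ∃ v ∈ occSet M, IsMinOn (fun q => entObj b (flat q)) (occSet M) v :=
  (isCompact_occSet M).exists_isMinOn (occSet_nonempty M)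
    ((continuous_entObj b).comp continuous_flat).continuousOn

theorem isMinOn_flat {M : EpisodicMDP S A H} {b : Fin H × S × A → ℝ} {v : Tab S A H}
    (h : IsMinOn (fun q => entObj b (flat q)) (occSet M) v) :
    IsMinOn (entObj b) (flat '' occSet M) (flat v) := by
  rintro _ ⟨q, hq, rfl⟩
  exact h hq

theorem argminOn_spec {β : Type*} [Preorder β] {f : Tab S A H → β} {D : Set (Tab S A H)}
    (h : ∃ v ∈ D, IsMinOn f D v) : argminOn f D ∈ D ∧ IsMinOn f D (argminOn f D) :=
  Classical.epsilon_spec (p := fun q => q ∈ D ∧ IsMinOn f D q) h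

/-- An occupancy measure that vanishes only where all occupancy measures vanish. -/
def HasFullSupport (M : EpisodicMDP S A H) (q : Tab S A H) : Prop :=
  q ∈ occSet M ∧ ∀ u ∈ occSet M, ∀ h s a, q h s a = 0 → u h s a = 0

theorem hasFullSupport_of_isMinOn [Nonempty A] {M : EpisodicMDP S A H}
    {b : Fin H × S × A → ℝ} {v : Tab S A H} (hv : v ∈ occSet M)
    (h : IsMinOn (fun q => entObj b (flat q)) (occSet M) v) : HasFullSupport M v :=
  ⟨hv, fun _ hu h' s a h0 => eq_zero_of_isMinOn (i := (h', s, a)) (convex_flat_occSet M)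
    nonneg_of_mem_flat_occSet sum_of_mem_flat_occSet (Set.mem_image_of_mem flat hv)
    (isMinOn_flat h) (Set.mem_image_of_mem flat hu) h0⟩

theorem initOcc_spec [Nonempty A] (M : EpisodicMDP S A H) : initOcc M ∈ occSet M ∧
    IsMinOn (fun q => entObj 0 (flat q)) (occSet M) (initOcc M) := by
  have e : (negEntropy : Tab S A H → ℝ) = fun q => entObj 0 (flat q) := funext fun q => by
    rw [entObj, sum_flat]
    simp [negEntropy, flat]
  rw [initOcc, e]
  exact argminOn_spec (exists_isMinOn_entObj M 0)

/-- The range of the regularizer: the entropy of an occupancy measure is between `0` and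
`H log (S A)`. -/
theorem relEnt_initOcc_le [Nonempty A] (M : EpisodicMDP S A H) {u : Tab S A H}
    (hu : u ∈ occSet M) : relEnt (flat u) (flat (initOcc M)) ≤
      H * Real.log ((Fintype.card S : ℝ) * Fintype.card A) := by
  obtain ⟨hv, hmin⟩ := initOcc_spec M
  have h₁ := relEnt_le_of_isMinOn (convex_flat_occSet M) nonneg_of_mem_flat_occSet
    sum_of_mem_flat_occSet (Set.mem_image_of_mem flat hv) (isMinOn_flat hmin)
    (Set.mem_image_of_mem flat hu)
  have h₂ : entObj 0 (flat u) ≤ 0 := Finset.sum_nonpos fun i _ => by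
    simp only [Pi.zero_apply, zero_mul, zero_add]
    exact mul_nonpos_of_nonneg_of_nonpos (nonneg_of_mem_occSet hu _ _ _)
      (Real.log_nonpos (nonneg_of_mem_occSet hu _ _ _) (le_one_of_mem_occSet hu _ _ _))
  have : Nonempty S := ⟨M.init⟩
  set n : ℝ := (Fintype.card S : ℝ) * Fintype.card A with hn
  have hn₀ : 0 < n := by positivity
  set v := flat (initOcc M)
  have hvs : ∑ i, v i = (H : ℝ) := sum_of_mem_flat_occSet v (Set.mem_image_of_mem flat hv)
  have h₃ : ∑ i : Fin H × S × A, (v i - 1 / n) ≤ ∑ i, v i * Real.log (v i / (1 / n)) :=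
    Finset.sum_le_sum fun i _ => sub_le_mul_log_div (nonneg_of_mem_occSet hv _ _ _)
      (by positivity) fun e => absurd e (by positivity)
  have h₄ : ∑ i, v i * Real.log (v i / (1 / n)) = entObj 0 v + H * Real.log n := by
    rw [← hvs, Finset.sum_mul, entObj, ← Finset.sum_add_distrib]
    refine Finset.sum_congr rfl fun i _ => ?_
    rw [mul_log_div_eq fun e => absurd e (by positivity), one_div, Real.log_inv]
    simp
  have h₅ : ∑ i : Fin H × S × A, (v i - 1 / n) = 0 := by
    rw [Finset.sum_sub_distrib, hvs, Finset.sum_const, Finset.card_univ]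
    simp only [Fintype.card_prod, Fintype.card_fin, nsmul_eq_mul, Nat.cast_mul, ← hn]
    field_simp
    simp
  linarith

/-- When `q` has full support, the extended-real objective of a mirror step is real on the set of
occupancy measures, and equals an entropic objective with linear part `η ĉ - log q`. -/
theorem coe_add_kl_eq {M : EpisodicMDP S A H} {q : Tab S A H} (hq : HasFullSupport M q) (η : ℝ)
    (chat : Tab S A H) {u : Tab S A H} (hu : u ∈ occSet M) :
    ((η * dot u chat : ℝ) : EReal) + kl u q =
      ((entObj (fun i => η * flat chat i - Real.log (flat q i)) (flat u) : ℝ) : EReal) := by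
  rw [kl, if_pos fun h s a h0 => hq.2 u hu h s a h0, ← EReal.coe_add, entObj, sum_flat, dot]
  congr 1
  simp only [Finset.mul_sum, ← Finset.sum_add_distrib, flat]
  refine Finset.sum_congr rfl fun h _ => Finset.sum_congr rfl fun s _ =>
    Finset.sum_congr rfl fun a _ => ?_
  rw [mul_log_div_eq fun e => hq.2 u hu h s a e]
  ring

theorem mirrorStep_spec [Nonempty A] {M : EpisodicMDP S A H} {q : Tab S A H}
    (hq : HasFullSupport M q) (η : ℝ) (chat : Tab S A H) :
    mirrorStep M η chat q ∈ occSet M ∧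
      IsMinOn (fun u => entObj (fun i => η * flat chat i - Real.log (flat q i)) (flat u))
        (occSet M) (mirrorStep M η chat q) := by
  obtain ⟨v, hv, hmin⟩ :=
    exists_isMinOn_entObj M fun i => η * flat chat i - Real.log (flat q i)
  have h := argminOn_spec (f := fun q' => ((η * dot q' chat : ℝ) : EReal) + kl q' q)
    (D := occSet M) ⟨v, hv, isMinOn_iff.2 fun u hu => by
      rw [coe_add_kl_eq hq η chat hu, coe_add_kl_eq hq η chat hv]
      exact EReal.coe_le_coe_iff.2 (hmin hu)⟩
  refine ⟨h.1, isMinOn_iff.2 fun u hu => ?_⟩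
  have := isMinOn_iff.1 h.2 u hu
  rw [coe_add_kl_eq hq η chat hu, coe_add_kl_eq hq η chat h.1] at this
  exact EReal.coe_le_coe_iff.1 this

theorem hasFullSupport_iterate [Nonempty A] (M : EpisodicMDP S A H) {m N : ℕ}
    (c : ℕ → Tab S A H) (η γ : ℝ) (k : ℕ) (ω : Fin k → Outcome S A H m N) :
    HasFullSupport M (iterate M c η γ k ω) := by
  induction k with
  | zero => exact hasFullSupport_of_isMinOn (initOcc_spec M).1 (initOcc_spec M).2
  | succ k ih =>
    have h := mirrorStep_spec (ih (Fin.init ω)) η (costEst M (c k) γ (ω (Fin.last k)))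
    exact hasFullSupport_of_isMinOn h.1 h.2

theorem dot_sub_dot_le_of_mirrorStep [Nonempty A] {M : EpisodicMDP S A H} {q : Tab S A H}
    (hq : HasFullSupport M q) {η : ℝ} (hη : 0 ≤ η) {chat : Tab S A H}
    (hc : ∀ h s a, 0 ≤ chat h s a) {u : Tab S A H} (hu : u ∈ occSet M) :
    η * (dot q chat - dot u chat) ≤
      relEnt (flat u) (flat q) - relEnt (flat u) (flat (mirrorStep M η chat q)) +
        η ^ 2 * dot q (fun h s a => chat h s a ^ 2) := by
  have h := mirrorStep_spec hq η chat
  have key := mirror_descent_step (x := fun i => η * flat chat i) (convex_flat_occSet M)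
    nonneg_of_mem_flat_occSet sum_of_mem_flat_occSet (Set.mem_image_of_mem flat hq.1)
    (by rintro _ ⟨w, hw, rfl⟩ i hi; exact hq.2 w hw _ _ _ hi)
    (fun i => mul_nonneg hη (hc _ _ _)) (Set.mem_image_of_mem flat h.1) (isMinOn_flat h.2)
    (Set.mem_image_of_mem flat hu)
  have e₁ : ∑ i, (flat q i - flat u i) * (η * flat chat i) = η * (dot q chat - dot u chat) := by
    rw [sum_flat]
    simp only [dot, flat, ← Finset.sum_sub_distrib, Finset.mul_sum]
    exact Finset.sum_congr rfl fun h _ => Finset.sum_congr rfl fun s _ =>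
      Finset.sum_congr rfl fun a _ => by ring
  have e₂ : ∑ i, flat q i * (η * flat chat i) ^ 2 =
      η ^ 2 * dot q (fun h s a => chat h s a ^ 2) := by
    rw [sum_flat]
    simp only [dot, flat, Finset.mul_sum]
    exact Finset.sum_congr rfl fun h _ => Finset.sum_congr rfl fun s _ =>
      Finset.sum_congr rfl fun a _ => by ring
  rwa [e₁, e₂] at key

theorem reachEst_nonneg (M : EpisodicMDP S A H) {m N : ℕ} (o : Outcome S A H m N) (h : Fin H)
    (s : S) (a : A) : 0 ≤ reachEst M o h s a :=
  div_nonneg (Finset.sum_nonneg fun n _ => by split_ifs <;> norm_num) (Nat.cast_nonneg N)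

theorem costEst_nonneg (M : EpisodicMDP S A H) {m N : ℕ} {c : Tab S A H} {γ : ℝ}
    (hc : ∀ h s a, 0 ≤ c h s a) (hγ : 0 ≤ γ) (o : Outcome S A H m N) (h : Fin H) (s : S) (a : A) :
    0 ≤ costEst M c γ o h s a := by
  unfold costEst
  split_ifs
  · exact div_nonneg (hc h s a) (add_nonneg (reachEst_nonneg M o h s a) hγ)
  · exact le_rfl

/-- The first `k` entries of a path. -/
def past {O : Type*} {K : ℕ} (ω : Fin K → O) (k : Fin K) : Fin k → O :=
  fun i => ω (Fin.castLE k.isLt.le i)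

/-- The sum of an adapted family of functions along a path; the `k`-th summand may depend on the
entries before the `k`-th one, and on this entry. -/
def pathSum {O : Type*} {K : ℕ} (Z : ∀ k : ℕ, (Fin k → O) → O → ℝ) (ω : Fin K → O) : ℝ :=
  ∑ k : Fin K, Z k (past ω k) (ω k)

theorem pathSum_succ {O : Type*} {K : ℕ} (Z : ∀ k : ℕ, (Fin k → O) → O → ℝ)
    (ω : Fin (K + 1) → O) :
    pathSum Z ω = pathSum Z (Fin.init ω) + Z K (Fin.init ω) (ω (Fin.last K)) := by
  rw [pathSum, Fin.sum_univ_castSucc]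
  rfl

theorem pathSum_snoc {O : Type*} {K : ℕ} (Z : ∀ k : ℕ, (Fin k → O) → O → ℝ)
    (ω : Fin K → O) (o : O) :
    pathSum Z (Fin.snoc (α := fun _ => O) ω o) = pathSum Z ω + Z K ω o := by
  rw [pathSum_succ, Fin.init_snoc, Fin.snoc_last]

/-- The regret of mirror descent against the estimated costs. -/
theorem mirror_descent_regret [Nonempty A] (M : EpisodicMDP S A H) {m N : ℕ} {c : ℕ → Tab S A H}
    {η γ : ℝ} (hη : 0 < η) (hγ : 0 ≤ γ) {K : ℕ} (hc : ∀ k < K, ∀ h s a, 0 ≤ c k h s a)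
    (ω : Fin K → Outcome S A H m N) {u : Tab S A H} (hu : u ∈ occSet M) :
    η * pathSum (fun k p o => dot (iterate M c η γ k p) (costEst M (c k) γ o) -
        dot u (costEst M (c k) γ o)) ω ≤
      H * Real.log ((Fintype.card S : ℝ) * Fintype.card A) +
        η ^ 2 * pathSum (fun k p o => dot (iterate M c η γ k p)
          fun h s a => costEst M (c k) γ o h s a ^ 2) ω := by
  have key : ∀ k (hk : k ≤ K) (ω : Fin k → Outcome S A H m N),
      η * pathSum (fun k p o => dot (iterate M c η γ k p) (costEst M (c k) γ o) -
        dot u (costEst M (c k) γ o)) ω ≤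
      relEnt (flat u) (flat (initOcc M)) - relEnt (flat u) (flat (iterate M c η γ k ω)) +
        η ^ 2 * pathSum (fun k p o => dot (iterate M c η γ k p)
          fun h s a => costEst M (c k) γ o h s a ^ 2) ω := by
    intro k
    induction k with
    | zero => intro _ ω; simp [pathSum, iterate]
    | succ k ih =>
      intro hk ω
      have h₁ := ih (by omega) (Fin.init ω)
      have h₂ := dot_sub_dot_le_of_mirrorStep
        (hasFullSupport_iterate M c η γ k (Fin.init ω)) hη.le
        (costEst_nonneg M (hc k hk) hγ (ω (Fin.last k))) hu
      rw [pathSum_succ, pathSum_succ, mul_add, mul_add, iterate]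
      linarith
  have h₁ := key K le_rfl ω
  have h₂ := relEnt_initOcc_le M hu
  have h₃ : 0 ≤ relEnt (flat u) (flat (iterate M c η γ K ω)) := by
    have hs := hasFullSupport_iterate M c η γ K ω
    have mu := Set.mem_image_of_mem flat hu
    have mv := Set.mem_image_of_mem flat hs.1
    exact relEnt_nonneg (nonneg_of_mem_flat_occSet _ mu) (nonneg_of_mem_flat_occSet _ mv)
      (fun i hi => hs.2 u hu _ _ _ hi)
      ((sum_of_mem_flat_occSet _ mu).trans (sum_of_mem_flat_occSet _ mv).symm)
  linarith

end MirrorDescent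

/-! ### Adapted sums along a run -/

section Run

variable {S : Type*} {A : Type*} {H : ℕ}
  [Fintype S] [DecidableEq S] [Fintype A] [DecidableEq A]

/-- A shortcut that keeps instance search for the space of runs within its size limit. -/
instance instFintypeRollout (m : ℕ) : Fintype (Rollout S A H m) := inferInstance

/-- A shortcut that keeps instance search for the space of runs within its size limit. -/
instance instFintypeOutcome (m N : ℕ) : Fintype (Outcome S A H m N) := inferInstance

variable [Nonempty A]

theorem expect_runLaw_succ (M : EpisodicMDP S A H) (m N : ℕ) (c : ℕ → Tab S A H) (η γ : ℝ)
    (k : ℕ) (F : (Fin (k + 1) → Outcome S A H m N) → ℝ) :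
    expect (runLaw M m N c η γ (k + 1)) F = expect (runLaw M m N c η γ k) fun ω =>
      expect (outcomeLaw M (policyOf (iterate M c η γ k ω)) m N) fun o =>
        F (Fin.snoc (α := fun _ => Outcome S A H m N) ω o) := by
  rw [runLaw, expect_bind]
  simp only [expect_map]

/-- If each increment has an exponential moment at most `1`, given the past, then so has the sum. -/
theorem expect_exp_pathSum_le_one (M : EpisodicMDP S A H) (m N : ℕ) (c : ℕ → Tab S A H) (η γ : ℝ)
    {K : ℕ} {Z : ∀ k : ℕ, (Fin k → Outcome S A H m N) → Outcome S A H m N → ℝ}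
    (hZ : ∀ k < K, ∀ ω, expect (outcomeLaw M (policyOf (iterate M c η γ k ω)) m N)
      (fun o => Real.exp (Z k ω o)) ≤ 1) :
    expect (runLaw M m N c η γ K) (fun ω => Real.exp (pathSum Z ω)) ≤ 1 := by
  induction K with
  | zero => simp [pathSum, expect_const]
  | succ K ih =>
    rw [expect_runLaw_succ]
    refine le_trans (expect_mono _ fun ω => ?_) (ih fun k hk => hZ k (by omega))
    simp only [pathSum_snoc, Real.exp_add, expect_const_mul]
    exact mul_le_of_le_one_right (Real.exp_pos _).le (hZ K (by omega) ω)

open scoped Classical in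
/-- Markov's inequality for the exponential of an adapted sum. -/
theorem prob_le_pathSum_le (M : EpisodicMDP S A H) (m N : ℕ) (c : ℕ → Tab S A H) (η γ : ℝ)
    {K : ℕ} {Z : ∀ k : ℕ, (Fin k → Outcome S A H m N) → Outcome S A H m N → ℝ}
    (hZ : ∀ k < K, ∀ ω, expect (outcomeLaw M (policyOf (iterate M c η γ k ω)) m N)
      (fun o => Real.exp (Z k ω o)) ≤ 1) (l : ℝ) :
    expect (runLaw M m N c η γ K) (fun ω => if l ≤ pathSum Z ω then 1 else 0) ≤
      Real.exp (-l) := by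
  calc expect (runLaw M m N c η γ K) (fun ω => if l ≤ pathSum Z ω then 1 else 0)
      ≤ expect (runLaw M m N c η γ K) (fun ω => Real.exp (-l) * Real.exp (pathSum Z ω)) := by
        refine expect_mono _ fun ω => ?_
        rw [← Real.exp_add]
        split_ifs with h
        · exact Real.one_le_exp (by linarith)
        · exact (Real.exp_pos _).le
    _ ≤ Real.exp (-l) := by
        rw [expect_const_mul]
        exact mul_le_of_le_one_right (Real.exp_pos _).le
          (expect_exp_pathSum_le_one M m N c η γ hZ)

theorem expect_pathSum_le (M : EpisodicMDP S A H) (m N : ℕ) (c : ℕ → Tab S A H) (η γ : ℝ)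
    {K : ℕ} {Z : ∀ k : ℕ, (Fin k → Outcome S A H m N) → Outcome S A H m N → ℝ} {ε : ℝ}
    (hZ : ∀ k < K, ∀ ω, expect (outcomeLaw M (policyOf (iterate M c η γ k ω)) m N) (Z k ω) ≤ ε) :
    expect (runLaw M m N c η γ K) (pathSum Z) ≤ K * ε := by
  induction K with
  | zero => simp [pathSum, expect]
  | succ K ih =>
    rw [expect_runLaw_succ]
    simp only [pathSum_snoc, expect_add, expect_const]
    have h₁ := ih fun k hk => hZ k (by omega)
    have h₂ := expect_le_of_le (runLaw M m N c η γ K) (hZ K (by omega))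
    push_cast
    linarith

end Run

/-! ### Exponential moments of the cost estimators -/

section ExpMoments

variable {S : Type*} {A : Type*} {H : ℕ}
  [Fintype S] [DecidableEq S] [Fintype A] [DecidableEq A]

open scoped Classical in
/-- The importance-weighted cost estimator with deterministic weights `1 / w`. For fixed simulated
episodes, `costEst` is by definition the case where `w` is the simulated reachability plus `γ`. -/
noncomputable def weightedEst (M : EpisodicMDP S A H) {m : ℕ} (c w : Tab S A H)
    (ρ : Rollout S A H m) : Tab S A H :=
  fun h s a => if Visited M ρ h s a then c h s a / w h s a else 0

theorem expect_weightedEst (M : EpisodicMDP S A H) (π : Policy S A H) (m : ℕ) (c w : Tab S A H)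
    (h : Fin H) (s : S) (a : A) :
    expect (rolloutLaw M π m) (fun ρ => weightedEst M c w ρ h s a) =
      reachProb M π m h s a * (c h s a / w h s a) := by
  rw [reachProb_eq_expect_visited, ← expect_mul_const]
  simp only [weightedEst, ite_mul, one_mul, zero_mul]

theorem expect_weightedEst_sq (M : EpisodicMDP S A H) (π : Policy S A H) (m : ℕ)
    (c w : Tab S A H) (h : Fin H) (s : S) (a : A) :
    expect (rolloutLaw M π m) (fun ρ => weightedEst M c w ρ h s a ^ 2) =
      reachProb M π m h s a * (c h s a / w h s a) ^ 2 := by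
  rw [reachProb_eq_expect_visited, ← expect_mul_const]
  simp only [weightedEst, ite_mul, one_mul, zero_mul, ite_pow, ne_eq, OfNat.ofNat_ne_zero,
    not_false_eq_true, zero_pow]

theorem expect_dot (M : EpisodicMDP S A H) (π : Policy S A H) (m : ℕ) (q : Tab S A H)
    (X : Rollout S A H m → Tab S A H) :
    expect (rolloutLaw M π m) (fun ρ => dot q (X ρ)) =
      dot q fun h s a => expect (rolloutLaw M π m) fun ρ => X ρ h s a := by
  simp only [dot, expect_sum, expect_const_mul]

/-- `H S (1 + A / m)`, the sum over all `(h,s,a)` of the reachability ratios `1 / m + π_h(a ∣ s)`. -/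
noncomputable def ratioSum (S A H m : ℕ) : ℝ := (H : ℝ) * S * (1 + (A : ℝ) / m)

theorem sum_ratio (π : Policy S A H) (m : ℕ) :
    ∑ h, ∑ s, ∑ a, (1 / (m : ℝ) + (π h s a).toReal) =
      ratioSum (Fintype.card S) (Fintype.card A) H m := by
  simp only [Finset.sum_add_distrib, sum_toReal_eq_one, Finset.sum_const, Finset.card_univ,
    nsmul_eq_mul, Fintype.card_fin, ratioSum]
  ring

/-- Implicit exploration: a weight exceeding the visiting probability by at least `γ / 2` makes the
exponential moment of the overestimation at most `1`, by `2 x / (2 + x) ≤ log (1 + x)`. -/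
theorem expect_exp_weightedEst_le_one (M : EpisodicMDP S A H) (π : Policy S A H) (m : ℕ)
    {c w : Tab S A H} {γ : ℝ} (hγ : 0 < γ) (h : Fin H) (s : S) (a : A)
    (hc : c h s a ∈ Set.Icc (0 : ℝ) 1) (hw : reachProb M π m h s a + γ / 2 ≤ w h s a) :
    expect (rolloutLaw M π m) (fun ρ => Real.exp (γ * (weightedEst M c w ρ h s a - c h s a))) ≤
      1 := by
  classical
  set W := reachProb M π m h s a with hW
  have hW₀ : 0 ≤ W := reachProb_nonneg M π m h s a
  set x := γ * c h s a with hx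
  have hx₀ : 0 ≤ x := mul_nonneg hγ.le hc.1
  have hxγ : x ≤ γ := mul_le_of_le_one_right hγ.le hc.2
  have hfun : ∀ ρ : Rollout S A H m, Real.exp (γ * (weightedEst M c w ρ h s a - c h s a)) =
      Real.exp (-x) * (1 + (Real.exp (x / w h s a) - 1) *
        if Visited M ρ h s a then 1 else 0) := by
    intro ρ
    by_cases hV : Visited M ρ h s a
    · rw [if_pos hV, mul_one, add_sub_cancel, ← Real.exp_add, weightedEst, if_pos hV]
      congr 1
      rw [hx]; ring
    · rw [if_neg hV, mul_zero, add_zero, mul_one, weightedEst, if_neg hV]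
      congr 1
      rw [hx]; ring
  simp only [hfun]
  rw [expect_const_mul, expect_add, expect_const, expect_const_mul, ← reachProb_eq_expect_visited,
    ← hW]
  have hmain : (Real.exp (x / w h s a) - 1) * W ≤ x := by
    rcases hW₀.eq_or_lt with h0 | hpos
    · rw [← h0, mul_zero]; exact hx₀
    · have h₁ : x / w h s a ≤ Real.log (1 + x / W) := by
        refine le_trans ?_ (Real.le_log_one_add_of_nonneg (div_nonneg hx₀ hW₀))
        have : 2 * (x / W) / (x / W + 2) = x / (W + x / 2) := by field_simp; ring
        rw [this]
        exact div_le_div_of_nonneg_left hx₀ (by positivity) (by linarith)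
      have h₂ : Real.exp (x / w h s a) ≤ 1 + x / W := by
        rw [← Real.le_log_iff_exp_le (by positivity)]
        exact h₁
      calc (Real.exp (x / w h s a) - 1) * W ≤ x / W * W :=
            mul_le_mul_of_nonneg_right (by linarith) hW₀
        _ = x := by field_simp
  calc Real.exp (-x) * (1 + (Real.exp (x / w h s a) - 1) * W)
      ≤ Real.exp (-x) * Real.exp x :=
        mul_le_mul_of_nonneg_left (by linarith [Real.add_one_le_exp x]) (Real.exp_pos _).le
    _ = 1 := by rw [← Real.exp_add]; simp

section Weighted

variable {M : EpisodicMDP S A H} {π : Policy S A H} {m : ℕ} {c w : Tab S A H} {γ : ℝ}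

theorem weightedEst_nonneg (hc : ∀ h s a, c h s a ∈ Set.Icc (0 : ℝ) 1) (hw₀ : ∀ h s a, 0 < w h s a)
    (ρ : Rollout S A H m) (h : Fin H) (s : S) (a : A) : 0 ≤ weightedEst M c w ρ h s a := by
  unfold weightedEst
  split_ifs
  · exact div_nonneg (hc h s a).1 (hw₀ h s a).le
  · exact le_rfl

theorem occupancy_div_le (hm : 0 < m) (hw₀ : ∀ h s a, 0 < w h s a)
    (hw : ∀ h s a, reachProb M π m h s a ≤ w h s a) (h : Fin H) (s : S) (a : A) :
    occupancy M π h s a / w h s a ≤ 1 / (m : ℝ) + (π h s a).toReal := by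
  rw [div_le_iff₀ (hw₀ h s a)]
  exact (occupancy_le_mul_reachProb M π hm h s a).trans
    (mul_le_mul_of_nonneg_left (hw h s a) (by positivity))

theorem occupancy_nonneg (h : Fin H) (s : S) (a : A) : 0 ≤ occupancy M π h s a :=
  mul_nonneg ENNReal.toReal_nonneg ENNReal.toReal_nonneg

theorem dot_weightedEst_nonneg (hc : ∀ h s a, c h s a ∈ Set.Icc (0 : ℝ) 1)
    (hw₀ : ∀ h s a, 0 < w h s a) (ρ : Rollout S A H m) :
    0 ≤ dot (occupancy M π) (weightedEst M c w ρ) :=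
  Finset.sum_nonneg fun h _ => Finset.sum_nonneg fun s _ => Finset.sum_nonneg fun a _ =>
    mul_nonneg (occupancy_nonneg h s a) (weightedEst_nonneg hc hw₀ ρ h s a)

/-- The estimated cost of the played policy is at most `H (1 + S)`: at each step at most `m` pairs
are visited, which accounts for the ratio `1 / m`, and the ratios `π_h(a ∣ s)` sum to `S`. -/
theorem dot_weightedEst_le (hm : 0 < m) (hc : ∀ h s a, c h s a ∈ Set.Icc (0 : ℝ) 1)
    (hw₀ : ∀ h s a, 0 < w h s a) (hw : ∀ h s a, reachProb M π m h s a ≤ w h s a)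
    (ρ : Rollout S A H m) :
    dot (occupancy M π) (weightedEst M c w ρ) ≤ H * (1 + (Fintype.card S : ℝ)) := by
  classical
  have hm' : (0 : ℝ) < m := Nat.cast_pos.2 hm
  have hterm : ∀ h s a, occupancy M π h s a * weightedEst M c w ρ h s a ≤
      1 / (m : ℝ) * (if Visited M ρ h s a then 1 else 0) + (π h s a).toReal := by
    intro h s a
    unfold weightedEst
    split_ifs
    · have h₁ := occupancy_div_le hm hw₀ hw h s a
      have h₂ : occupancy M π h s a * (c h s a / w h s a) ≤ occupancy M π h s a / w h s a := by
        rw [mul_div_assoc']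
        exact div_le_div_of_nonneg_right
          (mul_le_of_le_one_right (occupancy_nonneg h s a) (hc h s a).2) (hw₀ h s a).le
      linarith
    · simp
  calc dot (occupancy M π) (weightedEst M c w ρ)
      ≤ ∑ h, ∑ s, ∑ a, (1 / (m : ℝ) * (if Visited M ρ h s a then 1 else 0) + (π h s a).toReal) :=
        Finset.sum_le_sum fun h _ => Finset.sum_le_sum fun s _ => Finset.sum_le_sum fun a _ =>
          hterm h s a
    _ = ∑ h, (1 / (m : ℝ) * (∑ s, ∑ a, if Visited M ρ h s a then 1 else 0) + Fintype.card S) := by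
        simp only [Finset.sum_add_distrib, sum_toReal_eq_one, Finset.mul_sum]
        simp
    _ ≤ ∑ _h : Fin H, (1 + (Fintype.card S : ℝ)) := by
        refine Finset.sum_le_sum fun h _ => ?_
        have h₁ := mul_le_mul_of_nonneg_left (sum_visited_le (M := M) ρ h)
          (show 0 ≤ 1 / (m : ℝ) by positivity)
        rw [one_div_mul_cancel hm'.ne'] at h₁
        linarith
    _ = _ := by
        rw [Finset.sum_const, Finset.card_univ, Fintype.card_fin, nsmul_eq_mul]

theorem expect_dot_weightedEst_le (hc : ∀ h s a, c h s a ∈ Set.Icc (0 : ℝ) 1)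
    (hw₀ : ∀ h s a, 0 < w h s a) (hw : ∀ h s a, reachProb M π m h s a ≤ w h s a) :
    expect (rolloutLaw M π m) (fun ρ => dot (occupancy M π) (weightedEst M c w ρ)) ≤ H := by
  rw [expect_dot, ← sum_of_mem_occSet (M := M) (q := occupancy M π) ⟨π, rfl⟩]
  refine Finset.sum_le_sum fun h _ => Finset.sum_le_sum fun s _ => Finset.sum_le_sum fun a _ => ?_
  beta_reduce
  rw [expect_weightedEst]
  refine mul_le_of_le_one_right (occupancy_nonneg h s a) ?_
  rw [mul_div_assoc', div_le_one (hw₀ h s a)]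
  exact (mul_le_of_le_one_right (reachProb_nonneg ..) (hc h s a).2).trans (hw h s a)

/-- The bias of the estimated cost of the played policy. -/
theorem dot_sub_le_expect_dot_weightedEst (hm : 0 < m)
    (hc : ∀ h s a, c h s a ∈ Set.Icc (0 : ℝ) 1) (hw₀ : ∀ h s a, 0 < w h s a)
    (hw : ∀ h s a, reachProb M π m h s a ≤ w h s a) (hγ : 0 ≤ γ)
    (hw' : ∀ h s a, w h s a ≤ reachProb M π m h s a + 3 / 2 * γ) :
    dot (occupancy M π) c - 3 / 2 * γ * ratioSum (Fintype.card S) (Fintype.card A) H m ≤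
      expect (rolloutLaw M π m) (fun ρ => dot (occupancy M π) (weightedEst M c w ρ)) := by
  rw [expect_dot, ← sum_ratio π m]
  simp only [dot, Finset.mul_sum, ← Finset.sum_sub_distrib]
  refine Finset.sum_le_sum fun h _ => Finset.sum_le_sum fun s _ => Finset.sum_le_sum fun a _ => ?_
  rw [expect_weightedEst]
  have hw₀' := hw₀ h s a
  have h₁ := occupancy_div_le hm hw₀ hw h s a
  have hq : 0 ≤ occupancy M π h s a / w h s a := div_nonneg (occupancy_nonneg h s a) hw₀'.le
  have h₂ : occupancy M π h s a * c h s a -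
      occupancy M π h s a * (reachProb M π m h s a * (c h s a / w h s a)) =
        occupancy M π h s a / w h s a * (c h s a * (w h s a - reachProb M π m h s a)) := by
    field_simp
  have h₃ : c h s a * (w h s a - reachProb M π m h s a) ≤ 3 / 2 * γ :=
    (mul_le_of_le_one_left (by linarith [hw h s a]) (hc h s a).2).trans (by linarith [hw' h s a])
  have h₄ := mul_le_mul_of_nonneg_left h₃ hq
  have h₅ := mul_le_mul_of_nonneg_right h₁ (show 0 ≤ 3 / 2 * γ by positivity)
  linarith

/-- The played policy's cost is rarely underestimated: the estimated cost is nonnegative, with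
second moment at most `H² (1 + S)`, which controls the lower tail. -/
theorem expect_exp_sub_dot_weightedEst_le_one (hm : 0 < m)
    (hc : ∀ h s a, c h s a ∈ Set.Icc (0 : ℝ) 1) (hw₀ : ∀ h s a, 0 < w h s a)
    (hw : ∀ h s a, reachProb M π m h s a ≤ w h s a) (hγ : 0 ≤ γ)
    (hw' : ∀ h s a, w h s a ≤ reachProb M π m h s a + 3 / 2 * γ) {l : ℝ} (hl : 0 ≤ l) :
    expect (rolloutLaw M π m) (fun ρ => Real.exp (l * (dot (occupancy M π) c -
      3 / 2 * γ * ratioSum (Fintype.card S) (Fintype.card A) H m -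
        dot (occupancy M π) (weightedEst M c w ρ)) -
          l ^ 2 * (H * (H * (1 + (Fintype.card S : ℝ)))))) ≤ 1 := by
  set X : Rollout S A H m → ℝ := fun ρ => dot (occupancy M π) (weightedEst M c w ρ) with hX
  set B : ℝ := H * (1 + (Fintype.card S : ℝ)) with hB
  set d := dot (occupancy M π) c -
    3 / 2 * γ * ratioSum (Fintype.card S) (Fintype.card A) H m with hd
  have hB₀ : 0 ≤ B := by positivity
  have hX₀ : ∀ ρ, 0 ≤ X ρ := dot_weightedEst_nonneg hc hw₀
  have hXB : ∀ ρ, X ρ ≤ B := dot_weightedEst_le hm hc hw₀ hw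
  have hEd : d ≤ expect (rolloutLaw M π m) X :=
    dot_sub_le_expect_dot_weightedEst hm hc hw₀ hw hγ hw'
  have hEH : expect (rolloutLaw M π m) X ≤ H := expect_dot_weightedEst_le hc hw₀ hw
  have hmom : expect (rolloutLaw M π m) (fun ρ => Real.exp (-(l * X ρ))) ≤
      Real.exp (-(l * d) + l ^ 2 * (H * B)) := by
    calc expect (rolloutLaw M π m) (fun ρ => Real.exp (-(l * X ρ)))
        ≤ expect (rolloutLaw M π m) (fun ρ => 1 - l * X ρ + l ^ 2 * B * X ρ) := by
          refine expect_mono _ fun ρ => ?_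
          refine (exp_neg_le_quadratic (mul_nonneg hl (hX₀ ρ))).trans ?_
          have := mul_le_mul_of_nonneg_right (hXB ρ) (hX₀ ρ)
          have := mul_le_mul_of_nonneg_left this (sq_nonneg l)
          nlinarith
      _ = 1 - l * expect (rolloutLaw M π m) X + l ^ 2 * B * expect (rolloutLaw M π m) X := by
          rw [expect_add, expect_sub, expect_const, expect_const_mul, expect_const_mul]
      _ ≤ -(l * d) + l ^ 2 * (H * B) + 1 := by
          have h₁ := mul_le_mul_of_nonneg_left hEd hl
          have h₂ := mul_le_mul_of_nonneg_left hEH (mul_nonneg (sq_nonneg l) hB₀)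
          linarith
      _ ≤ _ := Real.add_one_le_exp _
  have hfun : ∀ ρ, Real.exp (l * (d - X ρ) - l ^ 2 * (H * B)) =
      Real.exp (l * d - l ^ 2 * (H * B)) * Real.exp (-(l * X ρ)) := fun ρ => by
    rw [← Real.exp_add]; congr 1; ring
  refine le_of_eq_of_le (congrArg (expect _) (funext hfun)) ?_
  rw [expect_const_mul]
  refine (mul_le_mul_of_nonneg_left hmom (Real.exp_pos _).le).trans (le_of_eq ?_)
  rw [← Real.exp_add, show l * d - l ^ 2 * (H * B) + (-(l * d) + l ^ 2 * (H * B)) = 0 by ring,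
    Real.exp_zero]

/-- The second-order term of mirror descent is at most `H (1 + S) / γ`, and its mean is at most the
sum of the reachability ratios. -/
theorem expect_exp_dot_sq_le_one (hH : 0 < H) (hm : 0 < m)
    (hc : ∀ h s a, c h s a ∈ Set.Icc (0 : ℝ) 1) (hγ : 0 < γ) (hγw : ∀ h s a, γ ≤ w h s a)
    (hw : ∀ h s a, reachProb M π m h s a ≤ w h s a) :
    expect (rolloutLaw M π m) (fun ρ => Real.exp ((γ *
      dot (occupancy M π) (fun h s a => weightedEst M c w ρ h s a ^ 2) -
        2 * γ * ratioSum (Fintype.card S) (Fintype.card A) H m) /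
          (H * (1 + (Fintype.card S : ℝ))))) ≤ 1 := by
  set Y : Rollout S A H m → ℝ :=
    fun ρ => dot (occupancy M π) (fun h s a => weightedEst M c w ρ h s a ^ 2) with hY
  set B : ℝ := H * (1 + (Fintype.card S : ℝ)) with hB
  set Λ := ratioSum (Fintype.card S) (Fintype.card A) H m with hΛ
  have hH' : (0 : ℝ) < H := Nat.cast_pos.2 hH
  have hB₀ : 0 < B := by positivity
  have hw₀ : ∀ h s a, 0 < w h s a := fun h s a => hγ.trans_le (hγw h s a)
  have hY₀ : ∀ ρ, 0 ≤ Y ρ := fun ρ => Finset.sum_nonneg fun h _ => Finset.sum_nonneg fun s _ =>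
    Finset.sum_nonneg fun a _ => mul_nonneg (occupancy_nonneg h s a) (sq_nonneg _)
  have hYB : ∀ ρ, γ * Y ρ ≤ B := fun ρ => by
    refine le_trans ?_ (dot_weightedEst_le hm hc hw₀ hw ρ)
    simp only [hY, dot, Finset.mul_sum]
    refine Finset.sum_le_sum fun h _ => Finset.sum_le_sum fun s _ =>
      Finset.sum_le_sum fun a _ => ?_
    have h₁ : γ * weightedEst M c w ρ h s a ≤ 1 := by
      unfold weightedEst
      split_ifs
      · rw [mul_div_assoc', div_le_one (hw₀ h s a)]
        exact (mul_le_of_le_one_right hγ.le (hc h s a).2).trans (hγw h s a)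
      · simp
    have h₂ := mul_le_mul_of_nonneg_left h₁
      (mul_nonneg (occupancy_nonneg (M := M) (π := π) h s a)
        (weightedEst_nonneg (M := M) hc hw₀ ρ h s a))
    linarith
  have hEY : expect (rolloutLaw M π m) Y ≤ Λ := by
    rw [hΛ, ← sum_ratio π m, hY, expect_dot]
    refine Finset.sum_le_sum fun h _ => Finset.sum_le_sum fun s _ =>
      Finset.sum_le_sum fun a _ => ?_
    beta_reduce
    rw [expect_weightedEst_sq]
    refine le_trans ?_ (occupancy_div_le hm hw₀ hw h s a)
    rw [div_eq_mul_one_div (occupancy M π h s a)]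
    refine mul_le_mul_of_nonneg_left ?_ (occupancy_nonneg h s a)
    have hw₀' := hw₀ h s a
    rw [div_pow, mul_div_assoc', div_le_div_iff₀ (by positivity) hw₀', one_mul]
    have h₁ : c h s a ^ 2 ≤ 1 := pow_le_one₀ (hc h s a).1 (hc h s a).2
    have h₂ : reachProb M π m h s a * c h s a ^ 2 ≤ w h s a :=
      (mul_le_of_le_one_right (reachProb_nonneg ..) h₁).trans (hw h s a)
    calc _ ≤ w h s a * w h s a := mul_le_mul_of_nonneg_right h₂ hw₀'.le
      _ = _ := by ring
  have hmom : expect (rolloutLaw M π m) (fun ρ => Real.exp (γ / B * Y ρ)) ≤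
      Real.exp (2 * γ * Λ / B) := by
    calc expect (rolloutLaw M π m) (fun ρ => Real.exp (γ / B * Y ρ))
        ≤ expect (rolloutLaw M π m) (fun ρ => 1 + 2 * γ / B * Y ρ) := by
          refine expect_mono _ fun ρ => ?_
          have h₀ : 0 ≤ γ / B * Y ρ := mul_nonneg (div_nonneg hγ.le hB₀.le) (hY₀ ρ)
          have h₁ : γ / B * Y ρ ≤ 1 := by
            rw [div_mul_eq_mul_div, div_le_one hB₀]
            exact hYB ρ
          have h₂ := Real.abs_exp_sub_one_sub_id_le (abs_le.2 ⟨by linarith, h₁⟩)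
          have h₃ := (abs_le.1 h₂).2
          have h₄ : 2 * γ / B * Y ρ = 2 * (γ / B * Y ρ) := by ring
          rw [h₄]
          nlinarith
      _ = 1 + 2 * γ / B * expect (rolloutLaw M π m) Y := by
          rw [expect_add, expect_const, expect_const_mul]
      _ ≤ 2 * γ * Λ / B + 1 := by
          have := mul_le_mul_of_nonneg_left hEY (show 0 ≤ 2 * γ / B by positivity)
          have e : 2 * γ * Λ / B = 2 * γ / B * Λ := by ring
          linarith
      _ ≤ _ := Real.add_one_le_exp _
  have hfun : ∀ ρ, Real.exp ((γ * Y ρ - 2 * γ * Λ) / B) =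
      Real.exp (-(2 * γ * Λ / B)) * Real.exp (γ / B * Y ρ) := fun ρ => by
    rw [← Real.exp_add]; congr 1; ring
  refine le_of_eq_of_le (congrArg (expect _) (funext hfun)) ?_
  rw [expect_const_mul]
  refine (mul_le_mul_of_nonneg_left hmom (Real.exp_pos _).le).trans (le_of_eq ?_)
  rw [← Real.exp_add, neg_add_cancel, Real.exp_zero]

end Weighted

end ExpMoments

/-! ### Accuracy of the simulated reachability -/

section Simulation

/-- Hoeffding's lemma on a finite probability space. -/
theorem expect_exp_sub_expect_le {Ω : Type*} [Fintype Ω] (μ : PMF Ω) {f : Ω → ℝ}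
    (hf : ∀ x, f x ∈ Set.Icc (0 : ℝ) 1) (t : ℝ) :
    expect μ (fun x => Real.exp (t * (f x - expect μ f))) ≤ Real.exp (t ^ 2 / 8) := by
  let _ : MeasurableSpace Ω := ⊤
  have hint : ∀ g : Ω → ℝ, ∫ x, g x ∂μ.toMeasure = expect μ g := fun g => by
    rw [PMF.integral_eq_sum]; rfl
  have h := (ProbabilityTheory.hasSubgaussianMGF_of_mem_Icc (μ := μ.toMeasure) (X := f) (a := 0)
    (b := 1) (measurable_of_finite f).aemeasurable (Filter.Eventually.of_forall hf)).mgf_le t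
  rw [ProbabilityTheory.mgf, hint, hint] at h
  refine h.trans (le_of_eq ?_)
  congr 1
  simp
  ring

theorem expect_piPMF_prod_subset {ι α : Type*} [Fintype ι] [DecidableEq ι] [Fintype α]
    (p : ι → PMF α) (s : Finset ι) (φ : ι → α → ℝ) :
    expect (piPMF p) (fun f => ∏ i ∈ s, φ i (f i)) = ∏ i ∈ s, expect (p i) (φ i) := by
  have h := expect_piPMF_prod p fun i x => if i ∈ s then φ i x else 1
  have e : ∀ i, expect (p i) (fun x => if i ∈ s then φ i x else 1) =
      if i ∈ s then expect (p i) (φ i) else 1 := fun i => by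
    split_ifs <;> simp [expect_const]
  simpa only [e, Finset.prod_ite_mem, Finset.univ_inter] using h

theorem expect_comm {Ω Ω' : Type*} [Fintype Ω] [Fintype Ω'] (μ : PMF Ω) (ν : PMF Ω')
    (F : Ω → Ω' → ℝ) :
    expect μ (fun x => expect ν fun y => F x y) = expect ν fun y => expect μ fun x => F x y := by
  simp only [expect, Finset.mul_sum]
  rw [Finset.sum_comm]
  exact Finset.sum_congr rfl fun y _ => Finset.sum_congr rfl fun x _ => by ring

variable {S : Type*} {A : Type*} {H : ℕ}
  [Fintype S] [DecidableEq S] [Fintype A] [DecidableEq A]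

/-- The law of the simulated episodes of one episode of the algorithm. -/
noncomputable def simLaw (M : EpisodicMDP S A H) (π : Policy S A H) (m N : ℕ) :
    PMF (Fin H × S × A × Fin N → Rollout S A H m) :=
  piPMF fun _ => rolloutLaw M π m

theorem expect_outcomeLaw (M : EpisodicMDP S A H) (π : Policy S A H) (m N : ℕ)
    (F : Outcome S A H m N → ℝ) :
    expect (outcomeLaw M π m N) F = expect (simLaw M π m N) fun sim =>
      expect (rolloutLaw M π m) fun ρ => F (ρ, sim) := by
  rw [outcomeLaw, expect_bind, ← expect_comm]
  simp only [expect_map]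
  rfl

/-- The fraction of the simulated episodes for `(h,s,a)` that visit `(s,a)` at step `h`, minus its
mean, has a sub-Gaussian exponential moment. -/
theorem expect_exp_reachEst_sub_le (M : EpisodicMDP S A H) (π : Policy S A H) (m : ℕ) {N : ℕ}
    (hN : 0 < N) (h : Fin H) (s : S) (a : A) (t : ℝ) :
    expect (outcomeLaw M π m N)
      (fun o => Real.exp (t * N * (reachEst M o h s a - reachProb M π m h s a))) ≤
        Real.exp (N * (t ^ 2 / 8)) := by
  classical
  set W := reachProb M π m h s a with hW
  have hN' : (N : ℝ) ≠ 0 := (Nat.cast_pos.2 hN).ne'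
  let e : Fin N ↪ Fin H × S × A × Fin N :=
    ⟨fun n => (h, s, a, n), fun n n' hn => by simpa using hn⟩
  let φ : Rollout S A H m → ℝ :=
    fun ρ => Real.exp (t * ((if Visited M ρ h s a then 1 else 0) - W))
  rw [expect_outcomeLaw]
  have hfun : ∀ (sim : Fin H × S × A × Fin N → Rollout S A H m) (ρ : Rollout S A H m),
      Real.exp (t * N * (reachEst M (ρ, sim) h s a - W)) =
        ∏ i ∈ Finset.univ.map e, φ (sim i) := by
    intro sim ρ
    rw [Finset.prod_map, ← Real.exp_sum, ← Finset.mul_sum, Finset.sum_sub_distrib,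
      Finset.sum_const, Finset.card_univ, Fintype.card_fin, nsmul_eq_mul, reachEst]
    congr 1
    field_simp
    rfl
  simp only [hfun, expect_const]
  rw [simLaw, expect_piPMF_prod_subset (fun _ => rolloutLaw M π m) _ fun _ => φ,
    Finset.prod_const, Finset.card_map, Finset.card_univ, Fintype.card_fin, Real.exp_nat_mul]
  refine pow_le_pow_left₀ (expect_nonneg _ fun ρ => (Real.exp_pos _).le) ?_ N
  have := expect_exp_sub_expect_le (rolloutLaw M π m)
    (f := fun ρ => if Visited M ρ h s a then 1 else 0)
    (fun ρ => by split_ifs <;> simp) t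
  rwa [← reachProb_eq_expect_visited, ← hW] at this

/-- The simulated reachability is within `γ / 2` of the true one, everywhere. -/
def GoodEst (M : EpisodicMDP S A H) (π : Policy S A H) {m N : ℕ} (γ : ℝ)
    (o : Outcome S A H m N) : Prop :=
  ∀ h s a, |reachEst M o h s a - reachProb M π m h s a| ≤ γ / 2

open scoped Classical in
theorem prob_not_goodEst_le (M : EpisodicMDP S A H) (π : Policy S A H) (m : ℕ) {N : ℕ}
    (hN : 0 < N) {γ : ℝ} (hγ : 0 ≤ γ) :
    expect (outcomeLaw M π m N) (fun o => if GoodEst M π γ o then 0 else 1) ≤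
      (H : ℝ) * Fintype.card S * Fintype.card A * (2 * Real.exp (-(N * γ ^ 2 / 2))) := by
  -- Chernoff's bound for both tails of each entry at `t = ± 2 γ`, which optimizes the exponent
  set e₀ := Real.exp (-(N * γ ^ 2)) with he₀
  have hpt : ∀ o : Outcome S A H m N, (if GoodEst M π γ o then (0 : ℝ) else 1) ≤
      ∑ h, ∑ s, ∑ a, (e₀ * Real.exp (2 * γ * N * (reachEst M o h s a - reachProb M π m h s a)) +
        e₀ * Real.exp (-(2 * γ) * N * (reachEst M o h s a - reachProb M π m h s a))) := by
    intro o
    have hnn : ∀ h s a,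
        0 ≤ e₀ * Real.exp (2 * γ * N * (reachEst M o h s a - reachProb M π m h s a)) +
        e₀ * Real.exp (-(2 * γ) * N * (reachEst M o h s a - reachProb M π m h s a)) :=
      fun h s a => by positivity
    split_ifs with hG
    · exact Finset.sum_nonneg fun h _ => Finset.sum_nonneg fun s _ => Finset.sum_nonneg fun a _ =>
        hnn h s a
    · simp only [GoodEst, not_forall, not_le] at hG
      obtain ⟨h, s, a, hbad⟩ := hG
      refine le_trans ?_ (Finset.single_le_sum (fun h _ => Finset.sum_nonneg fun s _ =>
        Finset.sum_nonneg fun a _ => hnn h s a) (Finset.mem_univ h))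
      refine le_trans ?_ (Finset.single_le_sum (fun s _ =>
        Finset.sum_nonneg fun a _ => hnn h s a) (Finset.mem_univ s))
      refine le_trans ?_ (Finset.single_le_sum (fun a _ => hnn h s a) (Finset.mem_univ a))
      have hγN : 0 ≤ 2 * γ * N := by positivity
      rw [he₀, ← Real.exp_add, ← Real.exp_add]
      rcases lt_abs.1 hbad with hb | hb
      · have := mul_le_mul_of_nonneg_left hb.le hγN
        have h₁ : 1 ≤ Real.exp (-(N * γ ^ 2) +
            2 * γ * N * (reachEst M o h s a - reachProb M π m h s a)) :=
          Real.one_le_exp (by linarith)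
        linarith [Real.exp_pos (-(N * γ ^ 2) +
            -(2 * γ) * N * (reachEst M o h s a - reachProb M π m h s a))]
      · have := mul_le_mul_of_nonneg_left hb.le hγN
        have h₁ : 1 ≤ Real.exp (-(N * γ ^ 2) +
            -(2 * γ) * N * (reachEst M o h s a - reachProb M π m h s a)) :=
          Real.one_le_exp (by linarith)
        linarith [Real.exp_pos (-(N * γ ^ 2) +
            2 * γ * N * (reachEst M o h s a - reachProb M π m h s a))]
  refine (expect_mono _ hpt).trans ?_
  simp only [expect_sum, expect_add, expect_const_mul]
  have hterm : ∀ h s a, e₀ * expect (outcomeLaw M π m N) (fun o =>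
        Real.exp (2 * γ * N * (reachEst M o h s a - reachProb M π m h s a))) +
      e₀ * expect (outcomeLaw M π m N) (fun o =>
        Real.exp (-(2 * γ) * N * (reachEst M o h s a - reachProb M π m h s a))) ≤
      2 * Real.exp (-(N * γ ^ 2 / 2)) := by
    intro h s a
    have h₁ := mul_le_mul_of_nonneg_left (expect_exp_reachEst_sub_le M π m hN h s a (2 * γ))
      (Real.exp_pos (-(N * γ ^ 2))).le
    have h₂ := mul_le_mul_of_nonneg_left (expect_exp_reachEst_sub_le M π m hN h s a (-(2 * γ)))
      (Real.exp_pos (-(N * γ ^ 2))).le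
    have e : -(N * γ ^ 2) + N * ((2 * γ) ^ 2 / 8) = -(N * γ ^ 2 / 2) := by ring
    rw [← Real.exp_add, e] at h₁
    rw [neg_sq, ← Real.exp_add, e] at h₂
    linarith
  refine (Finset.sum_le_sum fun h _ => Finset.sum_le_sum fun s _ => Finset.sum_le_sum fun a _ =>
    hterm h s a).trans (le_of_eq ?_)
  simp only [Finset.sum_const, Finset.card_univ, nsmul_eq_mul, Fintype.card_fin]
  ring

end Simulation

/-! ### The regret on the good event -/

section Regret

variable {S : Type*} {A : Type*} {H : ℕ}
  [Fintype S] [DecidableEq S] [Fintype A] [DecidableEq A] [Nonempty A]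

section Increments

variable (M : EpisodicMDP S A H) {m N : ℕ} (c : ℕ → Tab S A H) (γ : ℝ)

/-- The overestimation of one entry of the cost in one episode. -/
noncomputable def overInc (h : Fin H) (s : S) (a : A) (k : ℕ) (_ : Fin k → Outcome S A H m N)
    (o : Outcome S A H m N) : ℝ :=
  γ * (costEst M (c k) γ o h s a - c k h s a)

/-- The underestimation of the cost of the played policy in one episode, scaled by `l` and
compensated by its bias and its second moment. -/
noncomputable def underInc (l : ℝ) (k : ℕ) (p : Fin k → Outcome S A H m N)
    (o : Outcome S A H m N) : ℝ :=
  l * (dot (iterate M c γ γ k p) (c k) -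
    3 / 2 * γ * ratioSum (Fintype.card S) (Fintype.card A) H m -
      dot (iterate M c γ γ k p) (costEst M (c k) γ o)) -
        l ^ 2 * (H * (H * (1 + (Fintype.card S : ℝ))))

/-- The second-order term of mirror descent in one episode, scaled and compensated by its mean. -/
noncomputable def squareInc (k : ℕ) (p : Fin k → Outcome S A H m N)
    (o : Outcome S A H m N) : ℝ :=
  (γ * dot (iterate M c γ γ k p) (fun h s a => costEst M (c k) γ o h s a ^ 2) -
    2 * γ * ratioSum (Fintype.card S) (Fintype.card A) H m) / (H * (1 + (Fintype.card S : ℝ)))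

open scoped Classical in
/-- The restriction of an increment to the episodes with accurate simulated reachability. -/
noncomputable def onGood (Z : ∀ k : ℕ, (Fin k → Outcome S A H m N) → Outcome S A H m N → ℝ)
    (k : ℕ) (p : Fin k → Outcome S A H m N) (o : Outcome S A H m N) : ℝ :=
  if GoodEst M (policyOf (iterate M c γ γ k p)) γ o then Z k p o else 0

open scoped Classical in
/-- The indicator of the episodes with inaccurate simulated reachability. -/
noncomputable def badInc (k : ℕ) (p : Fin k → Outcome S A H m N) (o : Outcome S A H m N) : ℝ :=
  if GoodEst M (policyOf (iterate M c γ γ k p)) γ o then 0 else 1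

end Increments

theorem weights_of_goodEst {M : EpisodicMDP S A H} {π : Policy S A H} {m N : ℕ} {γ : ℝ}
    {o : Outcome S A H m N} (hG : GoodEst M π γ o) (h : Fin H) (s : S) (a : A) :
    reachProb M π m h s a + γ / 2 ≤ reachEst M o h s a + γ ∧
      reachEst M o h s a + γ ≤ reachProb M π m h s a + 3 / 2 * γ ∧
        γ ≤ reachEst M o h s a + γ := by
  obtain ⟨h₁, h₂⟩ := abs_le.1 (hG h s a)
  exact ⟨by linarith, by linarith, by linarith [reachEst_nonneg M o h s a]⟩

/-- To bound the exponential moment of an increment restricted to the accurate episodes, the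
simulated episodes may be taken as fixed and accurate. -/
theorem expect_exp_onGood_le_one (M : EpisodicMDP S A H) {m N : ℕ} (c : ℕ → Tab S A H) (γ : ℝ)
    {Z : ∀ k : ℕ, (Fin k → Outcome S A H m N) → Outcome S A H m N → ℝ} {k : ℕ}
    {p : Fin k → Outcome S A H m N}
    (hZ : ∀ ρ₀ sim, GoodEst M (policyOf (iterate M c γ γ k p)) γ (ρ₀, sim) →
      expect (rolloutLaw M (policyOf (iterate M c γ γ k p)) m)
        (fun ρ => Real.exp (Z k p (ρ, sim))) ≤ 1) :
    expect (outcomeLaw M (policyOf (iterate M c γ γ k p)) m N)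
      (fun o => Real.exp (onGood M c γ Z k p o)) ≤ 1 := by
  rw [expect_outcomeLaw]
  refine expect_le_of_le _ fun sim => ?_
  -- accuracy does not depend on the real episode
  have hconst : ∀ ρ ρ₀ : Rollout S A H m,
      GoodEst M (policyOf (iterate M c γ γ k p)) γ (ρ₀, sim) →
        GoodEst M (policyOf (iterate M c γ γ k p)) γ (ρ, sim) := fun _ _ h => h
  by_cases hG : ∃ ρ₀ : Rollout S A H m, GoodEst M (policyOf (iterate M c γ γ k p)) γ (ρ₀, sim)
  · obtain ⟨ρ₀, hG⟩ := hG
    simp only [onGood, if_pos (hconst _ ρ₀ hG)]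
    exact hZ ρ₀ sim hG
  · have hG' := not_exists.1 hG
    simp only [onGood, if_neg (hG' _), Real.exp_zero, expect_const]
    exact le_rfl

theorem occupancy_policyOf_iterate (M : EpisodicMDP S A H) {m N : ℕ} (c : ℕ → Tab S A H)
    (η γ : ℝ) (k : ℕ) (p : Fin k → Outcome S A H m N) :
    occupancy M (policyOf (iterate M c η γ k p)) = iterate M c η γ k p :=
  occupancy_policyOf (mem_occSet_iff.1 (hasFullSupport_iterate M c η γ k p).1)

section Moments

variable {M : EpisodicMDP S A H} {m N : ℕ} {c : ℕ → Tab S A H} {γ : ℝ} {k : ℕ}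

theorem expect_exp_overInc_le_one (hγ : 0 < γ)
    (hc : ∀ h s a, c k h s a ∈ Set.Icc (0 : ℝ) 1) (h : Fin H) (s : S) (a : A)
    (p : Fin k → Outcome S A H m N) :
    expect (outcomeLaw M (policyOf (iterate M c γ γ k p)) m N)
      (fun o => Real.exp (onGood M c γ (overInc M c γ h s a) k p o)) ≤ 1 :=
  expect_exp_onGood_le_one M c γ fun ρ₀ sim hG =>
    expect_exp_weightedEst_le_one M _ m (w := fun h s a => reachEst M (ρ₀, sim) h s a + γ)
      hγ h s a (hc h s a) (weights_of_goodEst hG h s a).1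

theorem expect_exp_underInc_le_one (hm : 0 < m) (hγ : 0 < γ)
    (hc : ∀ h s a, c k h s a ∈ Set.Icc (0 : ℝ) 1) {l : ℝ} (hl : 0 ≤ l)
    (p : Fin k → Outcome S A H m N) :
    expect (outcomeLaw M (policyOf (iterate M c γ γ k p)) m N)
      (fun o => Real.exp (onGood M c γ (underInc M c γ l) k p o)) ≤ 1 :=
  expect_exp_onGood_le_one M c γ fun ρ₀ sim hG => by
    have hw := weights_of_goodEst hG
    have := expect_exp_sub_dot_weightedEst_le_one (c := c k)
      (w := fun h s a => reachEst M (ρ₀, sim) h s a + γ) hm hc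
      (fun h s a => hγ.trans_le (hw h s a).2.2) (fun h s a => by linarith [(hw h s a).1]) hγ.le
      (fun h s a => (hw h s a).2.1) hl
    rw [occupancy_policyOf_iterate] at this
    exact this

theorem expect_exp_squareInc_le_one (hH : 0 < H) (hm : 0 < m) (hγ : 0 < γ)
    (hc : ∀ h s a, c k h s a ∈ Set.Icc (0 : ℝ) 1) (p : Fin k → Outcome S A H m N) :
    expect (outcomeLaw M (policyOf (iterate M c γ γ k p)) m N)
      (fun o => Real.exp (onGood M c γ (squareInc M c γ) k p o)) ≤ 1 :=
  expect_exp_onGood_le_one M c γ fun ρ₀ sim hG => by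
    have hw := weights_of_goodEst hG
    have := expect_exp_dot_sq_le_one (c := c k)
      (w := fun h s a => reachEst M (ρ₀, sim) h s a + γ) hH hm hc hγ
      (fun h s a => (hw h s a).2.2) (fun h s a => by linarith [(hw h s a).1])
    rw [occupancy_policyOf_iterate] at this
    exact this

end Moments

variable {M : EpisodicMDP S A H} {m N K : ℕ} {c : ℕ → Tab S A H} {γ : ℝ}

theorem pathSum_onGood {Z : ∀ k : ℕ, (Fin k → Outcome S A H m N) → Outcome S A H m N → ℝ}
    {ω : Fin K → Outcome S A H m N}
    (hG : ∀ k : Fin K, GoodEst M (policyOf (iterate M c γ γ k (past ω k))) γ (ω k)) :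
    pathSum (onGood M c γ Z) ω = pathSum Z ω :=
  Finset.sum_congr rfl fun k _ => if_pos (hG k)

theorem pathSum_badInc_nonneg (ω : Fin K → Outcome S A H m N) :
    0 ≤ pathSum (badInc M c γ) ω :=
  Finset.sum_nonneg fun k _ => by unfold badInc; split_ifs <;> norm_num

theorem one_le_pathSum_badInc {ω : Fin K → Outcome S A H m N}
    (hG : ¬ ∀ k : Fin K, GoodEst M (policyOf (iterate M c γ γ k (past ω k))) γ (ω k)) :
    1 ≤ pathSum (badInc M c γ) ω := by
  obtain ⟨k, hk⟩ := not_forall.1 hG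
  have h := Finset.single_le_sum (f := fun k : Fin K => badInc M c γ k (past ω k) (ω k))
    (fun k _ => by unfold badInc; split_ifs <;> norm_num) (Finset.mem_univ k)
  refine le_trans (le_of_eq ?_) h
  exact (if_neg hk).symm

/-- The regret bound of the good event, for a general weight `l` and confidence level `L`. -/
noncomputable def rawBound (S A H K m : ℕ) (γ l L : ℝ) : ℝ :=
  (3 / 2 * γ * ratioSum S A H m * K + L / l + l * (H * (H * (1 + (S : ℝ)))) * K) +
    (H * Real.log ((S : ℝ) * A) / γ + (2 * γ * ratioSum S A H m * K + H * (1 + (S : ℝ)) * L)) +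
      H * L / γ

theorem sum_dot_sub_dot_le (hH : 0 < H) (hγ : 0 < γ)
    (hc : ∀ k < K, ∀ h s a, c k h s a ∈ Set.Icc (0 : ℝ) 1) {l L : ℝ} (hl : 0 < l)
    {ω : Fin K → Outcome S A H m N}
    (hover : ∀ h s a, pathSum (overInc M c γ h s a) ω ≤ L)
    (hunder : pathSum (underInc M c γ l) ω ≤ L)
    (hsq : pathSum (squareInc M c γ) ω ≤ L) {u : Tab S A H} (hu : u ∈ occSet M) :
    ∑ k : Fin K, (dot (iterate M c γ γ k (past ω k)) (c k) - dot u (c k)) ≤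
      rawBound (Fintype.card S) (Fintype.card A) H K m γ l L := by
  set q : Fin K → Tab S A H := fun k => iterate M c γ γ k (past ω k) with hq
  set chat : Fin K → Tab S A H := fun k => costEst M (c k) γ (ω k) with hchat
  set Λ := ratioSum (Fintype.card S) (Fintype.card A) H m with hΛ
  set B : ℝ := H * (1 + (Fintype.card S : ℝ)) with hB
  have hH' : (0 : ℝ) < H := Nat.cast_pos.2 hH
  have hB₀ : 0 < B := by positivity
  -- the cost of the played policies is not underestimated by much
  have h₁ : ∑ k, (dot (q k) (c k) - dot (q k) (chat k)) ≤
      3 / 2 * γ * Λ * K + L / l + l * (H * B) * K := by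
    have e : pathSum (underInc M c γ l) ω =
        l * ∑ k, (dot (q k) (c k) - dot (q k) (chat k)) -
          (l * (3 / 2 * γ * Λ * K) + l * (l * (H * B) * K)) := by
      have : pathSum (underInc M c γ l) ω =
          ∑ k : Fin K, (l * (dot (q k) (c k) - dot (q k) (chat k)) -
            (l * (3 / 2 * γ * Λ) + l * (l * (H * B)))) :=
        Finset.sum_congr rfl fun k _ => by simp only [underInc, hq, hchat]; ring
      rw [this, Finset.sum_sub_distrib, ← Finset.mul_sum, Finset.sum_const, Finset.card_univ,
        Fintype.card_fin, nsmul_eq_mul]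
      ring
    rw [e] at hunder
    have hLl : l * (L / l) = L := by field_simp
    refine le_of_mul_le_mul_left ?_ hl
    calc _ ≤ L + (l * (3 / 2 * γ * Λ * K) + l * (l * (H * B) * K)) := by linarith
      _ = _ := by rw [mul_add, mul_add, hLl]; ring
  -- mirror descent on the estimated costs
  have h₂ : ∑ k, (dot (q k) (chat k) - dot u (chat k)) ≤
      H * Real.log ((Fintype.card S : ℝ) * Fintype.card A) / γ + (2 * γ * Λ * K + B * L) := by
    have hY : γ * ∑ k, dot (q k) (fun h s a => chat k h s a ^ 2) ≤ 2 * γ * Λ * K + B * L := by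
      have e : pathSum (squareInc M c γ) ω =
          (γ * ∑ k, dot (q k) (fun h s a => chat k h s a ^ 2) - 2 * γ * Λ * K) / B := by
        have : pathSum (squareInc M c γ) ω =
            (∑ k : Fin K, (γ * dot (q k) (fun h s a => chat k h s a ^ 2) - 2 * γ * Λ)) / B := by
          rw [Finset.sum_div]
          rfl
        rw [this, Finset.sum_sub_distrib, ← Finset.mul_sum, Finset.sum_const, Finset.card_univ,
          Fintype.card_fin, nsmul_eq_mul]
        ring
      rw [e, div_le_iff₀ hB₀] at hsq
      linarith
    have h := mirror_descent_regret M hγ hγ.le (fun k hk h s a => (hc k hk h s a).1) ω hu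
    have h' : γ * ∑ k, (dot (q k) (chat k) - dot u (chat k)) ≤
        H * Real.log ((Fintype.card S : ℝ) * Fintype.card A) +
          γ ^ 2 * ∑ k, dot (q k) (fun h s a => chat k h s a ^ 2) := h
    refine le_of_mul_le_mul_left ?_ hγ
    have h₃ := mul_le_mul_of_nonneg_left hY hγ.le
    calc _ ≤ _ := h'
      _ ≤ H * Real.log ((Fintype.card S : ℝ) * Fintype.card A) +
          γ * (2 * γ * Λ * K + B * L) := by linarith
      _ = _ := by field_simp
  -- the cost of the comparator is not overestimated by much
  have h₃ : ∑ k, (dot u (chat k) - dot u (c k)) ≤ H * L / γ := by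
    have e : ∑ k, (dot u (chat k) - dot u (c k)) =
        ∑ h, ∑ s, ∑ a, u h s a * ∑ k, (chat k h s a - c k h s a) := by
      simp only [dot, ← Finset.sum_sub_distrib, Finset.mul_sum, ← mul_sub]
      rw [Finset.sum_comm]
      refine Finset.sum_congr rfl fun h _ => ?_
      rw [Finset.sum_comm]
      refine Finset.sum_congr rfl fun s _ => ?_
      rw [Finset.sum_comm]
    have hk : ∀ h s a, ∑ k, (chat k h s a - c k h s a) ≤ L / γ := fun h s a => by
      rw [le_div_iff₀ hγ, mul_comm]
      have : γ * ∑ k, (chat k h s a - c k h s a) = pathSum (overInc M c γ h s a) ω := by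
        rw [Finset.mul_sum]; rfl
      rw [this]
      exact hover h s a
    rw [e]
    calc _ ≤ ∑ h, ∑ s, ∑ a, u h s a * (L / γ) :=
          Finset.sum_le_sum fun h _ => Finset.sum_le_sum fun s _ => Finset.sum_le_sum fun a _ =>
            mul_le_mul_of_nonneg_left (hk h s a) (nonneg_of_mem_occSet hu h s a)
      _ = _ := by
        simp only [← Finset.sum_mul]
        rw [sum_of_mem_occSet hu, mul_div_assoc]
  have e : ∑ k : Fin K, (dot (q k) (c k) - dot u (c k)) =
      ∑ k, (dot (q k) (c k) - dot (q k) (chat k)) +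
        ∑ k, (dot (q k) (chat k) - dot u (chat k)) + ∑ k, (dot u (chat k) - dot u (c k)) := by
    rw [← Finset.sum_add_distrib, ← Finset.sum_add_distrib]
    exact Finset.sum_congr rfl fun k _ => by ring
  rw [e, rawBound]
  linarith

/-- A bound on the regret against every policy bounds the regret of the team, as all agents play
the same policy. -/
theorem regret_le_of_forall (hm : 0 < m) {ω : Fin K → Outcome S A H m N} {R : ℝ}
    (hR : ∀ u ∈ occSet M,
      ∑ k : Fin K, (dot (iterate M c γ γ k (past ω k)) (c k) - dot u (c k)) ≤ R) :
    regret M c (agentPolicy M c γ γ ω) ≤ R := by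
  have : Nonempty (Fin m) := ⟨⟨0, hm⟩⟩
  have : Nonempty (Policy S A H) := ⟨fun _ _ => PMF.uniformOfFintype A⟩
  have hval : ∀ k : Fin K, ∀ v : Fin m, value M (c k) (agentPolicy M c γ γ ω k v) 0 M.init =
      dot (iterate M c γ γ k (past ω k)) (c k) := fun k v => by
    rw [value_eq_dot]
    exact congrArg (fun q => dot q (c k)) (occupancy_policyOf_iterate M c γ γ k (past ω k))
  simp only [regret, hval, value_eq_dot, ciSup_const]
  rw [sub_le_iff_le_add, ← sub_le_iff_le_add']
  refine le_ciInf fun π => ?_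
  have := hR (occupancy M π) ⟨π, rfl⟩
  rw [Finset.sum_sub_distrib] at this
  linarith

open scoped Classical in
/-- The regret exceeds the bound of the good event only if the simulation is inaccurate in some
episode, or one of the concentration bounds fails. -/
theorem prob_regret_le_rawBound (hH : 0 < H) (hm : 0 < m) (hN : 0 < N) (hγ : 0 < γ)
    (hc : ∀ k < K, ∀ h s a, c k h s a ∈ Set.Icc (0 : ℝ) 1) {l L : ℝ} (hl : 0 < l) :
    1 - ((H * Fintype.card S * Fintype.card A + 2) * Real.exp (-L) +
        K * (H * Fintype.card S * Fintype.card A * (2 * Real.exp (-(N * γ ^ 2 / 2))))) ≤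
      expect (runLaw M m N c γ γ K) fun ω =>
        if regret M c (agentPolicy M c γ γ ω) ≤
          rawBound (Fintype.card S) (Fintype.card A) H K m γ l L then 1 else 0 := by
  let μ := runLaw M m N c γ γ K
  let F : (Fin K → Outcome S A H m N) → ℝ := fun ω =>
    ((∑ h, ∑ s, ∑ a, if L ≤ pathSum (onGood M c γ (overInc M c γ h s a)) ω then 1 else 0) +
      (if L ≤ pathSum (onGood M c γ (underInc M c γ l)) ω then 1 else 0) +
      (if L ≤ pathSum (onGood M c γ (squareInc M c γ)) ω then 1 else 0)) +
      pathSum (badInc M c γ) ω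
  have hite : ∀ P : Prop, (0 : ℝ) ≤ if P then 1 else 0 := fun P => by split_ifs <;> norm_num
  have hpt : ∀ ω, 1 - F ω ≤ if regret M c (agentPolicy M c γ γ ω) ≤
      rawBound (Fintype.card S) (Fintype.card A) H K m γ l L then 1 else 0 := by
    intro ω
    have hs : 0 ≤ ∑ h, ∑ s, ∑ a,
        if L ≤ pathSum (onGood M c γ (overInc M c γ h s a)) ω then (1 : ℝ) else 0 :=
      Finset.sum_nonneg fun h _ => Finset.sum_nonneg fun s _ => Finset.sum_nonneg fun a _ =>
        hite _
    have hb := pathSum_badInc_nonneg (M := M) (c := c) (γ := γ) ω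
    have hu₀ := hite (L ≤ pathSum (onGood M c γ (underInc M c γ l)) ω)
    have hs₀ := hite (L ≤ pathSum (onGood M c γ (squareInc M c γ)) ω)
    by_cases hG : ∀ k : Fin K, GoodEst M (policyOf (iterate M c γ γ k (past ω k))) γ (ω k)
    swap
    · have := one_le_pathSum_badInc hG
      have := hite (regret M c (agentPolicy M c γ γ ω) ≤
        rawBound (Fintype.card S) (Fintype.card A) H K m γ l L)
      simp only [F]
      linarith
    by_cases hu : L ≤ pathSum (onGood M c γ (underInc M c γ l)) ω
    · have := hite (regret M c (agentPolicy M c γ γ ω) ≤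
        rawBound (Fintype.card S) (Fintype.card A) H K m γ l L)
      simp only [F]
      rw [if_pos hu]
      linarith
    by_cases hq : L ≤ pathSum (onGood M c γ (squareInc M c γ)) ω
    · have := hite (regret M c (agentPolicy M c γ γ ω) ≤
        rawBound (Fintype.card S) (Fintype.card A) H K m γ l L)
      simp only [F]
      rw [if_pos hq]
      linarith
    by_cases ho : ∀ h s a, pathSum (onGood M c γ (overInc M c γ h s a)) ω ≤ L
    · rw [if_pos]
      · simp only [F]
        linarith
      · rw [pathSum_onGood hG] at hu hq
        simp only [pathSum_onGood hG] at ho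
        exact regret_le_of_forall hm fun u hu' =>
          sum_dot_sub_dot_le hH hγ hc hl ho (not_le.1 hu).le (not_le.1 hq).le hu'
    · simp only [not_forall, not_le] at ho
      obtain ⟨h, s, a, ho⟩ := ho
      have h₁ : 1 ≤ ∑ h, ∑ s, ∑ a,
          if L ≤ pathSum (onGood M c γ (overInc M c γ h s a)) ω then (1 : ℝ) else 0 := by
        refine le_trans ?_ (Finset.single_le_sum (fun h _ => Finset.sum_nonneg fun s _ =>
          Finset.sum_nonneg fun a _ => hite _) (Finset.mem_univ h))
        refine le_trans ?_ (Finset.single_le_sum (fun s _ =>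
          Finset.sum_nonneg fun a _ => hite _) (Finset.mem_univ s))
        refine le_trans ?_ (Finset.single_le_sum (fun a _ => hite _) (Finset.mem_univ a))
        rw [if_pos ho.le]
      have := hite (regret M c (agentPolicy M c γ γ ω) ≤
        rawBound (Fintype.card S) (Fintype.card A) H K m γ l L)
      simp only [F]
      linarith
  refine le_trans ?_ (expect_mono μ hpt)
  rw [expect_sub, expect_const]
  refine sub_le_sub_left ?_ 1
  simp only [F, expect_add, expect_sum]
  have h₁ : ∀ h s a, expect μ (fun ω =>
      if L ≤ pathSum (onGood M c γ (overInc M c γ h s a)) ω then 1 else 0) ≤ Real.exp (-L) :=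
    fun h s a => prob_le_pathSum_le M m N c γ γ (fun k hk ω =>
      expect_exp_overInc_le_one hγ (hc k hk) h s a ω) L
  have h₂ : expect μ (fun ω =>
      if L ≤ pathSum (onGood M c γ (underInc M c γ l)) ω then 1 else 0) ≤ Real.exp (-L) :=
    prob_le_pathSum_le M m N c γ γ (fun k hk ω =>
      expect_exp_underInc_le_one hm hγ (hc k hk) hl.le ω) L
  have h₃ : expect μ (fun ω =>
      if L ≤ pathSum (onGood M c γ (squareInc M c γ)) ω then 1 else 0) ≤ Real.exp (-L) :=
    prob_le_pathSum_le M m N c γ γ (fun k hk ω =>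
      expect_exp_squareInc_le_one hH hm hγ (hc k hk) ω) L
  have h₄ : expect μ (fun ω => pathSum (badInc M c γ) ω) ≤
      K * (H * Fintype.card S * Fintype.card A * (2 * Real.exp (-(N * γ ^ 2 / 2)))) :=
    expect_pathSum_le M m N c γ γ fun k _ ω => prob_not_goodEst_le M _ m hN hγ.le
  have h₅ : ∑ h, ∑ s, ∑ a, expect μ (fun ω =>
      if L ≤ pathSum (onGood M c γ (overInc M c γ h s a)) ω then 1 else 0) ≤
        H * Fintype.card S * Fintype.card A * Real.exp (-L) := by
    refine (Finset.sum_le_sum fun h _ => Finset.sum_le_sum fun s _ => Finset.sum_le_sum fun a _ =>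
      h₁ h s a).trans (le_of_eq ?_)
    simp only [Finset.sum_const, Finset.card_univ, nsmul_eq_mul, Fintype.card_fin]
    ring
  linarith

end Regret

/-! ### Parameters -/

section Parameters

theorem sqrt_div_mul_self {x D : ℝ} (hx : 0 ≤ x) (hD : 0 < D) : √(x / D) * D = √(x * D) := by
  rw [Real.sqrt_div hx, Real.sqrt_mul hx, div_mul_eq_mul_div, div_eq_iff (by positivity),
    mul_assoc, Real.mul_self_sqrt hD.le]

theorem div_sqrt_div {x D : ℝ} (hx : 0 < x) (hD : 0 < D) : x / √(x / D) = √(x * D) := by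
  have h : 0 < √(x / D) := by positivity
  rw [← sqrt_div_mul_self hx.le hD, div_eq_iff h.ne', mul_right_comm,
    Real.mul_self_sqrt (by positivity), div_mul_cancel₀ _ hD.ne']

theorem sqrt_add_le {x y : ℝ} (hx : 0 ≤ x) (hy : 0 ≤ y) : √(x + y) ≤ √x + √y :=
  Real.sqrt_le_iff.2 ⟨by positivity, by
    nlinarith [Real.sq_sqrt hx, Real.sq_sqrt hy, mul_nonneg (Real.sqrt_nonneg x)
      (Real.sqrt_nonneg y)]⟩

variable {S A H K m : ℕ} {δ : ℝ}

theorem log_two_le_log_div (hn : (2 : ℝ) ≤ H * S * A) (hδ₀ : 0 < δ) (hδ₁ : δ < 1) :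
    Real.log 2 ≤ Real.log ((H : ℝ) * S * A / δ) := by
  refine Real.log_le_log two_pos ?_
  rw [le_div_iff₀ hδ₀]
  nlinarith

/-- With the prescribed rate, the bias, the second-order term and the entropy term are all multiples
of `H √((1 + A / m) S K log (H S A / δ))`, and the weight `l` balances `L / l` against the
second-moment term. The confidence level costs a factor `3` only, as `H S A ≥ 2`. -/
theorem rawBound_le (hS : 0 < S) (hA : 0 < A) (hH : 0 < H) (hK : 0 < K) (hm : 0 < m)
    (hn : (2 : ℝ) ≤ H * S * A) (hδ₀ : 0 < δ) (hδ₁ : δ < 1) :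
    rawBound S A H K m (rate S A H K m δ)
      (√(Real.log ((H : ℝ) * S * A / δ) / (S * K)) / H)
        (Real.log (4 * ((H : ℝ) * S * A) / δ)) ≤ 13 * regretBound S A H K m δ := by
  have hS' : (1 : ℝ) ≤ S := Nat.one_le_cast.2 hS
  have hA' : (1 : ℝ) ≤ A := Nat.one_le_cast.2 hA
  have hH' : (1 : ℝ) ≤ H := Nat.one_le_cast.2 hH
  have hK' : (1 : ℝ) ≤ K := Nat.one_le_cast.2 hK
  have hm' : (1 : ℝ) ≤ m := Nat.one_le_cast.2 hm
  have hlog2 := log_two_le_log_div hn hδ₀ hδ₁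
  have hlog₀ : 0 < Real.log 2 := Real.log_pos one_lt_two
  have hl4 : Real.log (4 * ((H : ℝ) * S * A) / δ) ≤ 3 * Real.log ((H : ℝ) * S * A / δ) := by
    have h4 : Real.log 4 = 2 * Real.log 2 := by
      rw [show (4 : ℝ) = 2 ^ 2 by norm_num, Real.log_pow]; norm_num
    rw [mul_div_assoc, Real.log_mul (by norm_num) (by positivity), h4]
    linarith
  have hSA : Real.log ((S : ℝ) * A) ≤ Real.log ((H : ℝ) * S * A / δ) := by
    refine Real.log_le_log (by positivity) ?_
    rw [le_div_iff₀ hδ₀, mul_assoc]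
    have h₁ : (S : ℝ) * A * δ ≤ S * A := mul_le_of_le_one_right (by positivity) hδ₁.le
    have h₂ : (S : ℝ) * A ≤ H * (S * A) := le_mul_of_one_le_left (by positivity) hH'
    linarith
  unfold regretBound rate rawBound ratioSum
  set x := Real.log ((H : ℝ) * S * A / δ) with hx
  set L := Real.log (4 * ((H : ℝ) * S * A) / δ) with hL
  have hx₀ : 0 < x := hlog₀.trans_le hlog2
  set D : ℝ := (1 + (A : ℝ) / m) * S * K with hD
  have hD₀ : 0 < D := by positivity
  set E : ℝ := (S : ℝ) * K with hE
  have hE₀ : 0 < E := by positivity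
  set γ := √(x / D) with hγ
  have hγ₀ : 0 < γ := by positivity
  set g := √(x / E) with hg
  have hg₀ : 0 < g := by positivity
  set R := H * √(E * x) with hR
  set T := √((H : ℝ) ^ 2 * S * A * K / m * x) with hT
  have hgE : g * E = √(E * x) := by rw [hg, sqrt_div_mul_self hx₀.le hE₀, mul_comm]
  have hxg : x / g = √(E * x) := by rw [hg, div_sqrt_div hx₀ hE₀, mul_comm]
  -- the common value of the bias, of the second-order term and of the range over the rate
  set Q := H * √(x * D) with hQ
  have hQ₁ : γ * ((H : ℝ) * S * (1 + (A : ℝ) / m)) * K = Q := by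
    rw [hQ, ← sqrt_div_mul_self hx₀.le hD₀, hD]; ring
  have hQ₂ : H * x / γ = Q := by rw [mul_div_assoc, hγ, div_sqrt_div hx₀ hD₀]
  have hQRT : Q ≤ R + T := by
    have e₁ : x * D = E * x + E * x * ((A : ℝ) / m) := by rw [hD, hE]; ring
    have e₂ : T = H * √(E * x * ((A : ℝ) / m)) := by
      rw [hT, show (H : ℝ) ^ 2 * S * A * K / m * x = H ^ 2 * (E * x * ((A : ℝ) / m)) by
        rw [hE]; ring, Real.sqrt_mul (by positivity), Real.sqrt_sq (by positivity)]
    rw [hQ, hR, e₂, e₁, ← mul_add]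
    refine mul_le_mul_of_nonneg_left ?_ (by positivity)
    exact sqrt_add_le (by positivity) (by positivity)
  have hR₀ : 0 ≤ R := by positivity
  have hT₀ : 0 ≤ T := by positivity
  have b₁ : L / (g / H) ≤ 3 * R := by
    calc L / (g / H) ≤ 3 * x / (g / H) := div_le_div_of_nonneg_right hl4 (by positivity)
      _ = 3 * (H * (x / g)) := by field_simp
      _ = 3 * R := by rw [hxg]
  have b₂ : g / H * (H * (H * (1 + (S : ℝ)))) * K ≤ 2 * R := by
    calc g / H * (H * (H * (1 + (S : ℝ)))) * K = g * H * K * (1 + S) := by field_simp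
      _ ≤ g * H * K * (2 * S) := mul_le_mul_of_nonneg_left (by linarith) (by positivity)
      _ = 2 * (H * (g * E)) := by rw [hE]; ring
      _ = 2 * R := by rw [hgE]
  have b₃ : H * Real.log ((S : ℝ) * A) / γ ≤ Q := by
    rw [← hQ₂]
    exact div_le_div_of_nonneg_right (mul_le_mul_of_nonneg_left hSA (by positivity)) hγ₀.le
  have b₄ : H * L / γ ≤ 3 * Q := by
    calc H * L / γ ≤ H * (3 * x) / γ :=
          div_le_div_of_nonneg_right (mul_le_mul_of_nonneg_left hl4 (by positivity)) hγ₀.le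
      _ = 3 * (H * x / γ) := by ring
      _ = 3 * Q := by rw [hQ₂]
  have b₅ : H * (1 + (S : ℝ)) * L ≤ 6 * (H * S * x) := by
    calc H * (1 + (S : ℝ)) * L ≤ H * (1 + (S : ℝ)) * (3 * x) :=
          mul_le_mul_of_nonneg_left hl4 (by positivity)
      _ ≤ H * (2 * S) * (3 * x) := mul_le_mul_of_nonneg_right
          (mul_le_mul_of_nonneg_left (by linarith) (by positivity)) (by positivity)
      _ = _ := by ring
  have b₆ : 0 ≤ (H : ℝ) * S * A / m * x := by positivity
  have b₇ : 0 ≤ (H : ℝ) * S * x := by positivity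
  have e₃ : 3 / 2 * γ * ((H : ℝ) * S * (1 + (A : ℝ) / m)) * K = 3 / 2 * Q := by
    rw [← hQ₁]; ring
  have e₄ : 2 * γ * ((H : ℝ) * S * (1 + (A : ℝ) / m)) * K = 2 * Q := by
    rw [← hQ₁]; ring
  rw [e₃, e₄]
  linarith

theorem rate_pos (hS : 0 < S) (hA : 0 < A) (hK : 0 < K)
    (hn : (2 : ℝ) ≤ H * S * A) (hδ₀ : 0 < δ) (hδ₁ : δ < 1) : 0 < rate S A H K m δ := by
  have hS' : (0 : ℝ) < S := Nat.cast_pos.2 hS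
  have hA' : (0 : ℝ) < A := Nat.cast_pos.2 hA
  have hK' : (0 : ℝ) < K := Nat.cast_pos.2 hK
  have := (Real.log_pos one_lt_two).trans_le (log_two_le_log_div hn hδ₀ hδ₁)
  exact Real.sqrt_pos.2 (by positivity)

theorem log_samples_pos (hK : 0 < K) (hm : 0 < m) (hn : (2 : ℝ) ≤ H * S * A) (hδ₀ : 0 < δ)
    (hδ₁ : δ < 1) : 0 < Real.log ((K : ℝ) * H * S * A * m / δ) := by
  have hK' : (1 : ℝ) ≤ K := Nat.one_le_cast.2 hK
  have hm' : (1 : ℝ) ≤ m := Nat.one_le_cast.2 hm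
  refine Real.log_pos ?_
  rw [lt_div_iff₀ hδ₀, one_mul]
  have h₁ : (1 : ℝ) ≤ K * m := one_le_mul_of_one_le_of_one_le hK' hm'
  have h₂ : 2 ≤ K * m * ((H : ℝ) * S * A) := by nlinarith
  nlinarith

theorem numSamples_pos (hK : 0 < K) (hm : 0 < m) (hn : (2 : ℝ) ≤ H * S * A) (hδ₀ : 0 < δ)
    (hδ₁ : δ < 1) {γ : ℝ} (hγ : 0 < γ) : 0 < numSamples S A H K m δ γ := by
  have := log_samples_pos hK hm hn hδ₀ hδ₁
  exact Nat.ceil_pos.2 (by positivity)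

/-- The failure probabilities of the concentration bounds and of the simulation sum to at most
`δ`. -/
theorem failure_le (hK : 0 < K) (hm : 0 < m) (hn : (2 : ℝ) ≤ H * S * A) (hδ₀ : 0 < δ)
    (hδ₁ : δ < 1) {γ : ℝ} (hγ : 0 < γ) :
    ((H : ℝ) * S * A + 2) * Real.exp (-Real.log (4 * ((H : ℝ) * S * A) / δ)) +
      K * ((H : ℝ) * S * A * (2 * Real.exp (-(numSamples S A H K m δ γ * γ ^ 2 / 2)))) ≤ δ := by
  have hlog := log_samples_pos hK hm hn hδ₀ hδ₁
  have hK' : (1 : ℝ) ≤ K := Nat.one_le_cast.2 hK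
  have hm' : (1 : ℝ) ≤ m := Nat.one_le_cast.2 hm
  have hN : 10 / γ ^ 2 * Real.log ((K : ℝ) * H * S * A * m / δ) ≤ numSamples S A H K m δ γ :=
    Nat.le_ceil _
  have e : (K : ℝ) * H * S * A * m / δ = K * (H * S * A) * m / δ := by ring
  rw [e] at hN hlog
  set n : ℝ := (H : ℝ) * S * A with hn'
  have hn₀ : 0 < n := by linarith
  set x := (K : ℝ) * n * m / δ with hx
  have hx₀ : 0 < x := by positivity
  have h₁ : (n + 2) * Real.exp (-Real.log (4 * n / δ)) ≤ δ / 2 := by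
    rw [Real.exp_neg, Real.exp_log (by positivity), inv_div, mul_div_assoc', div_le_div_iff₀
      (by positivity) two_pos]
    nlinarith
  have h₂ : Real.exp (-(numSamples S A H K m δ γ * γ ^ 2 / 2)) ≤ (x ^ 3)⁻¹ := by
    have : Real.exp (-(Real.log x * 3)) = (x ^ 3)⁻¹ := by
      rw [Real.exp_neg, mul_comm, ← Nat.cast_ofNat (n := 3), Real.exp_nat_mul,
        Real.exp_log hx₀]
    rw [← this, Real.exp_le_exp, neg_le_neg_iff]
    have h₃ := mul_le_mul_of_nonneg_right hN (sq_nonneg γ)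
    have h₄ : 10 / γ ^ 2 * Real.log x * γ ^ 2 = 10 * Real.log x := by field_simp
    linarith
  have h₃ : K * (n * (2 * (x ^ 3)⁻¹)) ≤ δ / 2 := by
    have hKm : 1 ≤ (K : ℝ) ^ 2 * m ^ 3 :=
      one_le_mul_of_one_le_of_one_le (one_le_pow₀ hK') (one_le_pow₀ hm')
    have hn4 : 4 ≤ n ^ 2 := by nlinarith
    have hden : 4 ≤ (K : ℝ) ^ 2 * m ^ 3 * n ^ 2 := by nlinarith
    have hδ3 : δ ^ 3 ≤ δ := by
      have := pow_le_pow_of_le_one hδ₀.le hδ₁.le (show 1 ≤ 3 by norm_num)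
      rwa [pow_one] at this
    have : K * (n * (2 * (x ^ 3)⁻¹)) = 2 * δ ^ 3 / ((K : ℝ) ^ 2 * m ^ 3 * n ^ 2) := by
      rw [hx]; field_simp
    rw [this, div_le_div_iff₀ (by positivity) two_pos]
    nlinarith
  have h₄ : K * (n * (2 * Real.exp (-(numSamples S A H K m δ γ * γ ^ 2 / 2)))) ≤
      K * (n * (2 * (x ^ 3)⁻¹)) := by gcongr
  linarith

end Parameters

/-! ### The high-probability regret bound -/

section HighProbability

theorem ofReal_le_toOuterMeasure {Ω : Type*} [Fintype Ω] (μ : PMF Ω) (s : Set Ω)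
    [DecidablePred (· ∈ s)] {r : ℝ} (h : r ≤ expect μ fun x => if x ∈ s then 1 else 0) :
    ENNReal.ofReal r ≤ μ.toOuterMeasure s := by
  classical
  have htop : μ.toOuterMeasure s ≠ ⊤ := by
    rw [PMF.toOuterMeasure_apply_fintype]
    refine ENNReal.sum_ne_top.2 fun x _ => ?_
    by_cases hx : x ∈ s <;> simp [hx, μ.apply_ne_top]
  rw [ENNReal.ofReal_le_iff_le_toReal htop, toReal_toOuterMeasure]
  convert h

variable {S : Type*} {A : Type*} {H : ℕ}
  [Fintype S] [Fintype A]

/-- With a single action there is only one policy, hence no regret. -/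
theorem regret_eq_zero_of_subsingleton [Nonempty A] [Subsingleton A] (M : EpisodicMDP S A H)
    (c : ℕ → Tab S A H) {K m : ℕ} (hm : 0 < m) (pol : Fin K → Fin m → Policy S A H) :
    regret M c pol = 0 := by
  have hp : ∀ (p : PMF A) (a : A), p a = 1 := fun p a => by
    have := p.tsum_coe
    rwa [tsum_fintype, Fintype.sum_subsingleton _ a] at this
  let π₀ : Policy S A H := fun _ _ => PMF.uniformOfFintype A
  have : Nonempty (Policy S A H) := ⟨π₀⟩
  have : Nonempty (Fin m) := ⟨⟨0, hm⟩⟩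
  have hπ : ∀ π : Policy S A H, π = π₀ := fun π => by
    funext h s
    exact PMF.ext fun a => by rw [hp, hp]
  simp only [regret, fun π : Policy S A H => hπ π, ciSup_const,
    ciInf_const, sub_self]

end HighProbability

end CoopMDP

theorem mainTheorem5 :
    -- The reachability ratio under non-fresh randomness.
    (∀ (S A : Type*) [Fintype S] [DecidableEq S] [Fintype A] [DecidableEq A]
      (H m : ℕ) (M : CoopMDP.EpisodicMDP S A H) (π : CoopMDP.Policy S A H)
      (h : Fin H) (s : S) (a : A), 0 < m →
        CoopMDP.occupancy M π h s a
          ≤ (1 / (m : ℝ) + (π h s a).toReal) * CoopMDP.reachProb M π m h s a) ∧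
    -- The regret bound, with an absolute constant `C`.
    ∃ C : ℝ, 0 < C ∧
      ∀ (S A : Type*) [Fintype S] [DecidableEq S] [Fintype A] [DecidableEq A] [Nonempty A]
        (H K m : ℕ) (M : CoopMDP.EpisodicMDP S A H) (c : ℕ → CoopMDP.Tab S A H) (δ η γ : ℝ)
        (N : ℕ),
        0 < H → 0 < K → 0 < m → 0 < δ → δ < 1 →
        (∀ k < K, ∀ h s a, c k h s a ∈ Set.Icc (0 : ℝ) 1) →
        η = CoopMDP.rate (Fintype.card S) (Fintype.card A) H K m δ →
        γ = η →
        N = CoopMDP.numSamples (Fintype.card S) (Fintype.card A) H K m δ γ →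
        ENNReal.ofReal (1 - δ) ≤
          (CoopMDP.runLaw M m N c η γ K).toOuterMeasure
            {ω | CoopMDP.regret M c (CoopMDP.agentPolicy M c η γ ω)
              ≤ C * CoopMDP.regretBound (Fintype.card S) (Fintype.card A) H K m δ} := by
  refine ⟨fun S A _ _ _ _ H m M π h s a hm =>
    CoopMDP.occupancy_le_mul_reachProb M π hm h s a, 13, by norm_num, ?_⟩
  intro S A _ _ _ _ _ H K m M c δ η γ N hH hK hm hδ₀ hδ₁ hc hη hγ hN
  subst hγ
  classical
  have : Nonempty S := ⟨M.init⟩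
  have hS : 0 < Fintype.card S := Fintype.card_pos
  have hA : 0 < Fintype.card A := Fintype.card_pos
  refine CoopMDP.ofReal_le_toOuterMeasure _ _ ?_
  rcases subsingleton_or_nontrivial A with hsub | hnon
  · -- for `H = S = A = 1` the logarithm may be arbitrarily small, so the tail bounds do not apply
    have hreg : ∀ pol : Fin K → Fin m → CoopMDP.Policy S A H,
        CoopMDP.regret M c pol ≤
          13 * CoopMDP.regretBound (Fintype.card S) (Fintype.card A) H K m δ := fun pol => by
      rw [CoopMDP.regret_eq_zero_of_subsingleton M c hm pol]
      have hcard : (1 : ℝ) ≤ (H : ℝ) * Fintype.card S * Fintype.card A := by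
        exact_mod_cast Nat.mul_pos (Nat.mul_pos hH hS) hA
      have : 0 ≤ Real.log ((H : ℝ) * Fintype.card S * Fintype.card A / δ) :=
        Real.log_nonneg (by rw [le_div_iff₀ hδ₀]; linarith)
      unfold CoopMDP.regretBound
      positivity
    simp only [Set.mem_ofPred_eq, hreg, if_true, CoopMDP.expect_const]
    linarith
  · have hn : (2 : ℝ) ≤ (H : ℝ) * Fintype.card S * Fintype.card A := by
      have h₁ : 1 ≤ H * Fintype.card S := Nat.mul_pos hH hS
      have h₂ : 2 ≤ H * Fintype.card S * Fintype.card A :=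
        (Fintype.one_lt_card : 1 < Fintype.card A).trans_le (Nat.le_mul_of_pos_left _ h₁)
      exact_mod_cast h₂
    have hγ : 0 < γ := hη ▸ CoopMDP.rate_pos hS hA hK hn hδ₀ hδ₁
    have hN₀ : 0 < N := hN ▸ CoopMDP.numSamples_pos hK hm hn hδ₀ hδ₁ hγ
    have hbound := CoopMDP.rawBound_le hS hA hH hK hm hn hδ₀ hδ₁
    have hlog := (Real.log_pos one_lt_two).trans_le (CoopMDP.log_two_le_log_div hn hδ₀ hδ₁)
    have hfail := CoopMDP.failure_le hK hm hn hδ₀ hδ₁ hγ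
    rw [← hN] at hfail
    rw [← hη] at hbound
    have hl : 0 < √(Real.log ((H : ℝ) * Fintype.card S * Fintype.card A / δ) /
        (Fintype.card S * K)) / H := by
      have hS' : (0 : ℝ) < Fintype.card S := Nat.cast_pos.2 hS
      have hK' : (0 : ℝ) < K := Nat.cast_pos.2 hK
      have hH' : (0 : ℝ) < H := Nat.cast_pos.2 hH
      positivity
    have hmain := CoopMDP.prob_regret_le_rawBound (M := M) hH hm hN₀ hγ hc hl
      (L := Real.log (4 * ((H : ℝ) * Fintype.card S * Fintype.card A) / δ))
    refine le_trans (by linarith) (hmain.trans (CoopMDP.expect_mono _ fun ω => ?_))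
    simp only [Set.mem_ofPred_eq]
    split_ifs with h₁ h₂ h₂
    · exact le_rfl
    · exact absurd (h₁.trans hbound) h₂
    · exact zero_le_one
    · exact le_rfl
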